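/- For $M\ge 1$ let $\Omega_M=\{1,2,3\}^M$, and for $\sigma\in\Omega_M$ let $s_c(\sigma)=\frac1M\,|\{l:\sigma_l=c\}|$, $c=1,2,3$. Let $\mu_M$ be the three-colour mean-field Potts distribution at the critical parameter $\tilde\beta_c=2\log 2$, $$\mu_M(\sigma)=\frac{\exp\big(M\tilde\beta_c\,(s_1(\sigma)^2+s_2(\sigma)^2+s_3(\sigma)^2)\big)}{\sum_{\tau\in\Omega_M}\exp\big(M\tilde\beta_c\,(s_1(\tau)^2+s_2(\tau)^2+s_3(\tau)^2)\big)},$$ and let $P$ be the Markov kernel of its Glauber dynamics: in each step a uniformly chosen spin is resampled from its conditional distribution under $\mu_M$ given the other spins. Let $C_1=(\frac23,\frac16,\frac16)$, $C_2=(\frac16,\frac23,\frac16)$, $C_3=(\frac16,\frac16,\frac23)$, $C_4=(\frac13,\frac13,\frac13)$ and $\rho=10^{-6}$. The modes are $F_M^{(i)}=\{\sigma\in\Omega_M: s_i(\sigma)>\frac12\}$ for $i=1,2,3$ and $F_M^{(4)}=\Omega_M\setminus(F_M^{(1)}\cup F_M^{(2)}\cup F_M^{(3)})$; the inner regions are $$\mathcal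 I_M^{(i)}=\Big\{\sigma\in\Omega_M: -\frac{\rho}{4}\le s_c(\sigma)-C_{i,c}\le\frac{\rho}{2}\ \text{ for } c=1,2,3\Big\},\qquad 1\le i\le 4.$$ Let $\mu_M^{(i)}(\sigma)=\mu_M(\sigma)\mathbf 1[\sigma\in F_M^{(i)}]/\mu_M(F_M^{(i)})$ be the restriction of $\mu_M$ to $F_M^{(i)}$, and let $d_{\mathrm{TV}}(\eta_1,\eta_2)=\frac12\sup_{f:\Omega_M\to[-1,1]}|\eta_1(f)-\eta_2(f)|$. Proposition. There are absolute constants $C,C'>0$ and $M_0$ such that for every integer $M\ge M_0$, every integer $k\ge 330\,M\log M$, every $1\le i\le 4$ and every $\sigma\in\mathcal I_M^{(i)}$, $$d_{\mathrm{TV}}\big(P^k(\sigma,\cdot),\mu_M^{(i)}\big)\le\frac{C}{M^2}+3k^2\exp(-C'M).$$ -/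

import Mathlib

open scoped BigOperators

noncomputable section

namespace MeanFieldPotts

/-- Configurations of `M` spins, each with one of three colours. -/
abbrev Config (M : ℕ) : Type := Fin M → Fin 3

/-- The ratio `s_c(σ)` of spins of colour `c` in the configuration `σ`. -/
def ratio {M : ℕ} (σ : Config M) (c : Fin 3) : ℝ :=
  ((Finset.univ.filter (fun l : Fin M => σ l = c)).card : ℝ) / (M : ℝ)

/-- The unnormalised Gibbs weight `exp (M β (s₁² + s₂² + s₃²))`. -/
def weight (β : ℝ) {M : ℕ} (σ : Config M) : ℝ :=
  Real.exp ((M : ℝ) * β * ∑ c : Fin 3, ratio σ c ^ 2)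

/-- The three-colour mean-field Potts distribution on `M` spins with parameter `β`
(its probability mass function). -/
def gibbs (β : ℝ) (M : ℕ) (σ : Config M) : ℝ :=
  weight β σ / ∑ τ : Config M, weight β τ

/-- The critical parameter `2 log 2`. -/
def criticalBeta : ℝ := 2 * Real.log 2

/-- The conditional probability, under the probability mass function `μ`, that the spin at `v` has
colour `c`, given that all the other spins are as in `σ`. -/
def condProb {M : ℕ} (μ : Config M → ℝ) (σ : Config M) (v : Fin M) (c : Fin 3) : ℝ :=
  μ (Function.update σ v c) / ∑ b : Fin 3, μ (Function.update σ v b)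

/-- The transition matrix of the Glauber dynamics for `μ`: a uniformly chosen spin is resampled
from its conditional distribution under `μ` given the other spins. -/
def glauber {M : ℕ} (μ : Config M → ℝ) : Matrix (Config M) (Config M) ℝ :=
  Matrix.of fun σ τ =>
    (1 / (M : ℝ)) * ∑ v : Fin M, ∑ c : Fin 3,
      if Function.update σ v c = τ then condProb μ σ v c else 0

/-- The four centres (barycentric coordinates). -/
def centre : Fin 4 → Fin 3 → ℝ :=
  ![![2 / 3, 1 / 6, 1 / 6], ![1 / 6, 2 / 3, 1 / 6], ![1 / 6, 1 / 6, 2 / 3],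
    ![1 / 3, 1 / 3, 1 / 3]]

/-- Configurations in which colour `c` has a strict majority. -/
def majority (M : ℕ) (c : Fin 3) : Set (Config M) := {σ | 1 / 2 < ratio σ c}

/-- The four modes: strict majority of one of the three colours, and all the other
configurations. -/
def mode (M : ℕ) : Fin 4 → Set (Config M) :=
  ![majority M 0, majority M 1, majority M 2,
    (majority M 0 ∪ majority M 1 ∪ majority M 2)ᶜ]

/-- The size parameter of the inner regions. -/
def rho : ℝ := 1 / 10 ^ 6

/-- The inner region of the mode `i`: the colour ratios lie in a small triangle around the `i`-th
centre. -/
def innerRegion (M : ℕ) (i : Fin 4) : Set (Config M) :=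
  {σ | ∀ c : Fin 3, -(rho / 4) ≤ ratio σ c - centre i c ∧ ratio σ c - centre i c ≤ rho / 2}

open scoped Classical in
/-- The restriction of the probability mass function `μ` to the set `F`, renormalised. -/
def restrictTo {α : Type*} [Fintype α] (μ : α → ℝ) (F : Set α) (x : α) : ℝ :=
  (if x ∈ F then μ x else 0) / ∑ y : α, if y ∈ F then μ y else 0

/-- Total variation distance of two mass functions on a finite set:
half of the supremum of `|p(f) - q(f)|` over all functions `f` with values in `[-1,1]`. -/
def dTV {α : Type*} [Fintype α] (p q : α → ℝ) : ℝ :=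
  (1 / 2) * ⨆ f : {f : α → ℝ // ∀ x, f x ∈ Set.Icc (-1 : ℝ) 1},
    |∑ x, p x * f.1 x - ∑ x, q x * f.1 x|

end MeanFieldPotts

end

/-!
Near a centre the conditional law of a spin is a contraction of the colour ratios of the other
spins. Truncating the ratios to a small box therefore yields a single-site dynamics that contracts
everywhere and mixes in `O(M log M)` steps by Dobrushin's criterion. It coincides with the Glauber
dynamics as long as the ratios stay in a triangular core around the centre, and an exponential
Lyapunov function shows that a chain started in the inner region leaves the core only with
exponentially small probability. Finally the Gibbs measure restricted to a mode is almost
stationary, because a mode carries exponentially little mass outside its core: linearising the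
energy turns the Gibbs weights into product weights, whose partition functions are governed by a
dual free energy that is maximal, at the critical parameter, exactly at the four centres.
-/

noncomputable section

namespace MeanFieldPotts

open Matrix Function Real

section MarkovChain

variable {α : Type*} [Fintype α] {P Q : Matrix α α ℝ} {μ : α → ℝ} {U F : Set α}

/-- The mass `μ(F)` of the set `F` under the mass function `μ`. -/
def mass (μ : α → ℝ) (F : Set α) : ℝ := ∑ x, F.indicator μ x

lemma abs_indicator_dotProduct_sub_le_of_eqOn (hμ : ∀ x, 0 ≤ μ x) {g h : α → ℝ}
    (hg : ∀ x, |g x| ≤ 1) (hh : ∀ x, |h x| ≤ 1) (hU : Set.EqOn g h U) :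
    |F.indicator μ ⬝ᵥ g - F.indicator μ ⬝ᵥ h| ≤ 2 * mass μ (F \ U) := by
  rw [← dotProduct_sub, mass, Finset.mul_sum]
  refine (Finset.abs_sum_le_sum_abs _ _).trans (Finset.sum_le_sum fun x _ => ?_)
  by_cases hx : x ∈ F <;> by_cases hxU : x ∈ U
  · simp [hx, hxU, hU hxU]
  · have : |g x - h x| ≤ 2 := (abs_sub _ _).trans (by linarith [hg x, hh x])
    simpa [hx, hxU, abs_mul, abs_of_nonneg (hμ x), mul_comm] using
      mul_le_mul_of_nonneg_left this (hμ x)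
  · simp [hx]
  · simp [hx]

lemma sum_restrictTo_mul (μ : α → ℝ) (F : Set α) (f : α → ℝ) :
    ∑ x, restrictTo μ F x * f x = (F.indicator μ ⬝ᵥ f) / mass μ F := by
  classical
  simp only [restrictTo, dotProduct, mass, Finset.sum_div, Set.indicator_apply, div_mul_eq_mul_div]

lemma dTV_le {p q : α → ℝ} {b : ℝ}
    (h : ∀ f : α → ℝ, (∀ x, |f x| ≤ 1) → |∑ x, p x * f x - ∑ x, q x * f x| ≤ 2 * b) :
    dTV p q ≤ b := by
  have : Nonempty {f : α → ℝ // ∀ x, f x ∈ Set.Icc (-1 : ℝ) 1} := ⟨⟨0, by simp⟩⟩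
  have := ciSup_le fun f : {f : α → ℝ // ∀ x, f x ∈ Set.Icc (-1 : ℝ) 1} =>
    h f fun x => abs_le.2 (f.2 x)
  rw [dTV]
  linarith

lemma abs_sub_dotProduct_div_mass_le (hμ : ∀ x, 0 ≤ μ x) (hF : 0 < mass μ F) {g : α → ℝ} {δ : ℝ}
    (hg : ∀ x y, |g x - g y| ≤ δ) (x : α) :
    |g x - (F.indicator μ ⬝ᵥ g) / mass μ F| ≤ δ := by
  rw [← mul_le_mul_iff_left₀ hF, ← abs_of_pos hF, ← abs_mul, sub_mul, abs_of_pos hF,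
    div_mul_cancel₀ _ hF.ne', mass, Finset.mul_sum, Finset.mul_sum, dotProduct,
    ← Finset.sum_sub_distrib]
  refine (Finset.abs_sum_le_sum_abs _ _).trans (Finset.sum_le_sum fun y _ => ?_)
  have hν : 0 ≤ F.indicator μ y := Set.indicator_nonneg (fun z _ => hμ z) y
  calc |g x * F.indicator μ y - F.indicator μ y * g y| = |g x - g y| * F.indicator μ y := by
        rw [mul_comm (F.indicator μ y), ← sub_mul, abs_mul, abs_of_nonneg hν]
    _ ≤ δ * F.indicator μ y := mul_le_mul_of_nonneg_right (hg x y) hν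

variable [DecidableEq α]

lemma mulVec_const (hP : P ∈ rowStochastic ℝ α) (b : ℝ) (x : α) : (P *ᵥ fun _ => b) x = b := by
  simp only [mulVec, dotProduct, ← Finset.sum_mul, sum_row_of_mem_rowStochastic hP x, one_mul]

lemma abs_mulVec_le (hP : P ∈ rowStochastic ℝ α) {f g : α → ℝ} (hfg : ∀ y, |f y| ≤ g y) (x : α) :
    |(P *ᵥ f) x| ≤ (P *ᵥ g) x :=
  (Finset.abs_sum_le_sum_abs _ _).trans <| Finset.sum_le_sum fun y _ => by
    rw [abs_mul, abs_of_nonneg (nonneg_of_mem_rowStochastic hP)]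
    exact mul_le_mul_of_nonneg_left (hfg y) (nonneg_of_mem_rowStochastic hP)

lemma abs_mulVec_le_of_forall_abs_le (hP : P ∈ rowStochastic ℝ α) {f : α → ℝ} {b : ℝ}
    (hf : ∀ y, |f y| ≤ b) (x : α) : |(P *ᵥ f) x| ≤ b :=
  (abs_mulVec_le hP hf x).trans_eq (mulVec_const hP b x)

lemma abs_pow_mulVec_sub_pow_mulVec_le (hP : P ∈ rowStochastic ℝ α) (hQ : Q ∈ rowStochastic ℝ α)
    (hPQ : ∀ x ∈ U, P x = Q x) {V : α → ℝ} {ε : ℝ} (hε : 0 ≤ ε) (hV : ∀ x, 0 ≤ V x)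
    (hVU : ∀ x ∉ U, 1 ≤ V x) (hPV : ∀ x ∈ U, (P *ᵥ V) x ≤ V x + ε) {f : α → ℝ}
    (hf : ∀ x, |f x| ≤ 1) (k : ℕ) (x : α) :
    |(P ^ k *ᵥ f) x - (Q ^ k *ᵥ f) x| ≤ 2 * (V x + k * ε) := by
  induction k generalizing x with
  | zero => simpa using hV x
  | succ k ih =>
    by_cases hx : x ∈ U
    · have hrow : (Q *ᵥ (Q ^ k *ᵥ f)) x = (P *ᵥ (Q ^ k *ᵥ f)) x := by
        simp only [mulVec, hPQ x hx]
      calc |(P ^ (k + 1) *ᵥ f) x - (Q ^ (k + 1) *ᵥ f) x|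
          = |(P *ᵥ (P ^ k *ᵥ f - Q ^ k *ᵥ f)) x| := by
            rw [pow_succ', pow_succ', ← mulVec_mulVec, ← mulVec_mulVec, hrow, mulVec_sub,
              Pi.sub_apply]
        _ ≤ (P *ᵥ (2 • V + fun _ => 2 * (k * ε))) x :=
            abs_mulVec_le hP (fun y => (ih y).trans_eq (by simp [mul_add])) x
        _ = 2 * (P *ᵥ V) x + 2 * (k * ε) := by
            rw [mulVec_add, Pi.add_apply, mulVec_const hP, mulVec_smul]; simp
        _ ≤ 2 * (V x + (k + 1 : ℕ) * ε) := by
            push_cast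
            linarith [hPV x hx]
    · have hle := fun {R : Matrix α α ℝ} (hR : R ∈ rowStochastic ℝ α) =>
        abs_le.1 (abs_mulVec_le_of_forall_abs_le (pow_mem hR (k + 1)) hf x)
      have : 0 ≤ ((k + 1 : ℕ) : ℝ) * ε := by positivity
      rw [abs_le]
      constructor <;> linarith [hVU x hx, (hle hP).1, (hle hP).2, (hle hQ).1, (hle hQ).2]

/-- By stationarity the restriction of `μ` to `F` loses mass in `F` and gains mass outside. -/
lemma abs_vecMul_indicator_sub (hP : P ∈ rowStochastic ℝ α) (hμ : ∀ x, 0 ≤ μ x) (hμP : μ ᵥ* P = μ)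
    (y : α) : |(F.indicator μ ᵥ* P) y - F.indicator μ y| =
      ((F.indicator μ ᵥ* P) y - F.indicator μ y) * (1 - 2 * F.indicator 1 y) := by
  by_cases hy : y ∈ F
  · have : (F.indicator μ ᵥ* P) y ≤ F.indicator μ y := calc
      (F.indicator μ ᵥ* P) y ≤ (μ ᵥ* P) y := Finset.sum_le_sum fun x _ =>
          mul_le_mul_of_nonneg_right (Set.indicator_le_self' (fun _ _ => hμ _) x)
            (nonneg_of_mem_rowStochastic hP)
      _ = F.indicator μ y := by rw [hμP, Set.indicator_of_mem hy]
    rw [abs_of_nonpos (sub_nonpos.2 this), Set.indicator_of_mem hy 1, Pi.one_apply]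
    ring
  · have : 0 ≤ (F.indicator μ ᵥ* P) y := Finset.sum_nonneg fun x _ =>
      mul_nonneg (Set.indicator_nonneg (fun z _ => hμ z) x) (nonneg_of_mem_rowStochastic hP)
    simpa [hy] using this

/-- The flow out of `F` starts in `F \ U`, and by stationarity it balances the flow into `F`. -/
lemma abs_indicator_dotProduct_mulVec_sub_le (hP : P ∈ rowStochastic ℝ α) (hμ : ∀ x, 0 ≤ μ x)
    (hμP : μ ᵥ* P = μ) (hU : ∀ x ∈ U, (P *ᵥ F.indicator 1) x = 1)
    {f : α → ℝ} (hf : ∀ x, |f x| ≤ 1) :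
    |F.indicator μ ⬝ᵥ P *ᵥ f - F.indicator μ ⬝ᵥ f| ≤ 2 * mass μ (F \ U) := by
  set ν := F.indicator μ
  set χ : α → ℝ := F.indicator 1
  have hχ : ∀ x, 0 ≤ χ x := Set.indicator_nonneg fun y _ => zero_le_one
  have hνχ : ν ⬝ᵥ χ = ν ⬝ᵥ 1 := Finset.sum_congr rfl fun x _ => by
    by_cases hx : x ∈ F <;> simp [ν, χ, hx]
  calc |ν ⬝ᵥ P *ᵥ f - ν ⬝ᵥ f|
      = |∑ y, ((ν ᵥ* P) y - ν y) * f y| := by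
        rw [dotProduct_mulVec, ← sub_dotProduct]; rfl
    _ ≤ ∑ y, |(ν ᵥ* P) y - ν y| := (Finset.abs_sum_le_sum_abs _ _).trans <|
        Finset.sum_le_sum fun y _ => by
          rw [abs_mul]; exact mul_le_of_le_one_right (abs_nonneg _) (hf y)
    _ = (ν ᵥ* P - ν) ⬝ᵥ (1 - (2 : ℝ) • χ) := Finset.sum_congr rfl fun y _ => by
        simp [ν, χ, abs_vecMul_indicator_sub hP hμ hμP y]
    _ = 2 * (ν ⬝ᵥ (1 - P *ᵥ χ)) := by
        rw [sub_dotProduct, ← dotProduct_mulVec, mulVec_sub, mulVec_smul,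
          one_vecMul_of_mem_rowStochastic hP]
        simp only [dotProduct_sub, dotProduct_smul, hνχ, smul_eq_mul]
        ring
    _ ≤ 2 * mass μ (F \ U) := by
        refine mul_le_mul_of_nonneg_left (Finset.sum_le_sum fun x _ => ?_) zero_le_two
        have hPχ : 0 ≤ (P *ᵥ χ) x :=
          Finset.sum_nonneg fun y _ => mul_nonneg (nonneg_of_mem_rowStochastic hP) (hχ y)
        by_cases hx : x ∈ F <;> by_cases hxU : x ∈ U
        · simp [χ, hx, hxU, hU x hxU]
        · simpa [ν, hx, hxU, mul_sub] using mul_nonneg (hμ x) hPχ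
        · simp [ν, hx]
        · simp [ν, hx]

lemma abs_indicator_dotProduct_pow_mulVec_sub_le (hP : P ∈ rowStochastic ℝ α)
    (hQ : Q ∈ rowStochastic ℝ α) (hPQ : ∀ x ∈ U, P x = Q x) (hμ : ∀ x, 0 ≤ μ x)
    (hμP : μ ᵥ* P = μ) (hU : ∀ x ∈ U, (P *ᵥ F.indicator 1) x = 1)
    {f : α → ℝ} (hf : ∀ x, |f x| ≤ 1) (k : ℕ) :
    |F.indicator μ ⬝ᵥ Q ^ k *ᵥ f - F.indicator μ ⬝ᵥ f| ≤ 4 * k * mass μ (F \ U) := by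
  induction k with
  | zero => simp
  | succ k ih =>
    have hk := abs_mulVec_le_of_forall_abs_le (pow_mem hQ k) hf
    have hQP : |F.indicator μ ⬝ᵥ Q *ᵥ (Q ^ k *ᵥ f) - F.indicator μ ⬝ᵥ P *ᵥ (Q ^ k *ᵥ f)| ≤
        2 * mass μ (F \ U) :=
      abs_indicator_dotProduct_sub_le_of_eqOn hμ (abs_mulVec_le_of_forall_abs_le hQ hk)
        (abs_mulVec_le_of_forall_abs_le hP hk) fun x hx => by simp only [mulVec, hPQ x hx]
    have hPk := abs_indicator_dotProduct_mulVec_sub_le hP hμ hμP hU hk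
    rw [pow_succ', ← mulVec_mulVec]
    push_cast
    linarith [abs_sub_le (F.indicator μ ⬝ᵥ Q *ᵥ (Q ^ k *ᵥ f))
        (F.indicator μ ⬝ᵥ P *ᵥ (Q ^ k *ᵥ f)) (F.indicator μ ⬝ᵥ f),
      abs_sub_le (F.indicator μ ⬝ᵥ P *ᵥ (Q ^ k *ᵥ f)) (F.indicator μ ⬝ᵥ Q ^ k *ᵥ f)
        (F.indicator μ ⬝ᵥ f)]

lemma dTV_pow_restrictTo_le (hP : P ∈ rowStochastic ℝ α) (hQ : Q ∈ rowStochastic ℝ α)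
    (hPQ : ∀ x ∈ U, P x = Q x) (hμ : ∀ x, 0 ≤ μ x) (hμP : μ ᵥ* P = μ) (hF : 0 < mass μ F)
    (hU : ∀ x ∈ U, (P *ᵥ F.indicator 1) x = 1) {V : α → ℝ} {ε : ℝ} (hε : 0 ≤ ε)
    (hV : ∀ x, 0 ≤ V x) (hVU : ∀ x ∉ U, 1 ≤ V x) (hPV : ∀ x ∈ U, (P *ᵥ V) x ≤ V x + ε)
    {k : ℕ} {δ : ℝ}
    (hmix : ∀ f : α → ℝ, (∀ x, |f x| ≤ 1) → ∀ x y, |(Q ^ k *ᵥ f) x - (Q ^ k *ᵥ f) y| ≤ δ) (x : α) :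
    dTV ((P ^ k) x) (restrictTo μ F) ≤
      δ / 2 + (V x + k * ε) + 2 * k * (mass μ (F \ U) / mass μ F) := by
  refine dTV_le fun f hf => ?_
  have hcompare := abs_pow_mulVec_sub_pow_mulVec_le hP hQ hPQ hε hV hVU hPV hf k x
  have haverage := abs_sub_dotProduct_div_mass_le hμ hF (hmix f hf) x
  have hstationary : |(F.indicator μ ⬝ᵥ Q ^ k *ᵥ f) / mass μ F - (F.indicator μ ⬝ᵥ f) / mass μ F| ≤
      4 * k * (mass μ (F \ U) / mass μ F) := by
    rw [← sub_div, abs_div, abs_of_pos hF, ← mul_div_assoc]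
    gcongr
    exact abs_indicator_dotProduct_pow_mulVec_sub_le hP hQ hPQ hμ hμP hU hf k
  rw [sum_restrictTo_mul]
  change |(P ^ k *ᵥ f) x - _| ≤ _
  linarith [abs_sub_le ((P ^ k *ᵥ f) x) ((Q ^ k *ᵥ f) x) ((F.indicator μ ⬝ᵥ f) / mass μ F),
    abs_sub_le ((Q ^ k *ᵥ f) x) ((F.indicator μ ⬝ᵥ Q ^ k *ᵥ f) / mass μ F)
      ((F.indicator μ ⬝ᵥ f) / mass μ F)]

end MarkovChain

section SingleSite

variable {ι S : Type*} [Fintype ι] [DecidableEq ι] [Fintype S]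

lemma abs_dotProduct_le_of_sum_eq_zero {D h : S → ℝ} {α : ℝ} (hD : ∑ c, D c = 0)
    (hh : ∀ c d, |h c - h d| ≤ α) : |D ⬝ᵥ h| ≤ α / 2 * ∑ c, |D c| := by
  cases isEmpty_or_nonempty S
  · simp
  obtain ⟨cmax, hmax⟩ := Finite.exists_max h
  obtain ⟨cmin, hmin⟩ := Finite.exists_min h
  have hrange := (abs_le.1 (hh cmax cmin)).2
  set mid := (h cmax + h cmin) / 2 with hmid
  have hcentred : D ⬝ᵥ h = ∑ c, D c * (h c - mid) := by
    simp only [mul_sub, Finset.sum_sub_distrib, ← Finset.sum_mul, hD, zero_mul, sub_zero]; rfl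
  rw [hcentred, Finset.mul_sum]
  refine (Finset.abs_sum_le_sum_abs _ _).trans (Finset.sum_le_sum fun c _ => ?_)
  rw [abs_mul, mul_comm]
  refine mul_le_mul_of_nonneg_right (abs_le.2 ⟨?_, ?_⟩) (abs_nonneg _) <;>
    linarith [hmax c, hmin c, hmid]

lemma abs_dotProduct_le_of_mem_stdSimplex {p h : S → ℝ} {α : ℝ} (hp : p ∈ stdSimplex ℝ S)
    (hh : ∀ c, |h c| ≤ α) : |p ⬝ᵥ h| ≤ α := calc
  |p ⬝ᵥ h| ≤ ∑ c, p c * α := (Finset.abs_sum_le_sum_abs _ _).trans <|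
    Finset.sum_le_sum fun c _ => by
      rw [abs_mul, abs_of_nonneg (hp.1 c)]; exact mul_le_mul_of_nonneg_left (hh c) (hp.1 c)
  _ = α := by rw [← Finset.sum_mul, hp.2, one_mul]

lemma abs_dotProduct_sub_dotProduct_le {p p' g g' : S → ℝ} {α θ : ℝ} (hα : 0 ≤ α)
    (hp : p ∈ stdSimplex ℝ S) (hp' : p' ∈ stdSimplex ℝ S) (hpp' : ∑ c, |p' c - p c| ≤ 2 * θ)
    (hg : ∀ c d, |g c - g d| ≤ α) (hgg' : ∀ c, |g' c - g c| ≤ α) :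
    |p' ⬝ᵥ g' - p ⬝ᵥ g| ≤ (1 + θ) * α := by
  have hmove : |p' ⬝ᵥ (g' - g)| ≤ α := abs_dotProduct_le_of_mem_stdSimplex hp' hgg'
  have hlaw : |(p' - p) ⬝ᵥ g| ≤ α / 2 * (2 * θ) :=
    (abs_dotProduct_le_of_sum_eq_zero (by simp [hp.2, hp'.2]) hg).trans
      (mul_le_mul_of_nonneg_left hpp' (by positivity))
  calc |p' ⬝ᵥ g' - p ⬝ᵥ g| = |p' ⬝ᵥ (g' - g) + (p' - p) ⬝ᵥ g| := by
        rw [dotProduct_sub, sub_dotProduct, sub_add_sub_cancel]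
    _ ≤ (1 + θ) * α := by linarith [abs_add_le (p' ⬝ᵥ (g' - g)) ((p' - p) ⬝ᵥ g)]

/-- The function `h` on configurations changes by at most `α` when a single spin is changed, that
is, `h` is `α`-Lipschitz for the Hamming distance. -/
def HasOscillation (α : ℝ) (h : (ι → S) → ℝ) : Prop :=
  ∀ σ w a, |h (update σ w a) - h σ| ≤ α

omit [Fintype S] in
lemma HasOscillation.abs_sub_le {α : ℝ} {h : (ι → S) → ℝ} (hh : HasOscillation α h)
    (σ τ : ι → S) : |h τ - h σ| ≤ Fintype.card ι * α := by
  suffices ∀ s : Finset ι, |h (s.piecewise τ σ) - h σ| ≤ s.card * α by simpa using this Finset.univ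
  intro s
  induction s using Finset.induction_on with
  | empty => simp
  | insert v s hv ih =>
    rw [Finset.piecewise_insert, Finset.card_insert_of_notMem hv]
    have := (_root_.abs_sub_le _ (h (s.piecewise τ σ)) (h σ)).trans
      (add_le_add (hh (s.piecewise τ σ) v (τ v)) ih)
    push_cast
    linarith

variable [DecidableEq S]

/-- The transition matrix of the single-site dynamics with update rule `q`: a uniformly chosen site
`v` of the configuration `σ` gets a new spin, which is `c` with probability `q σ v c`. -/
def singleSite (q : (ι → S) → ι → S → ℝ) : Matrix (ι → S) (ι → S) ℝ :=
  of fun σ τ => 1 / (Fintype.card ι : ℝ) * ∑ v, ∑ c, if update σ v c = τ then q σ v c else 0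

variable {q : (ι → S) → ι → S → ℝ}

lemma singleSite_mulVec_apply (q : (ι → S) → ι → S → ℝ) (h : (ι → S) → ℝ) (σ : ι → S) :
    (singleSite q *ᵥ h) σ =
      1 / (Fintype.card ι : ℝ) * ∑ v, q σ v ⬝ᵥ fun c => h (update σ v c) := by
  simp only [mulVec, dotProduct, singleSite, of_apply, mul_assoc, Finset.sum_mul, ← Finset.mul_sum]
  rw [Finset.sum_comm]
  congr! 2 with v
  rw [Finset.sum_comm]
  simp

lemma singleSite_mem_rowStochastic [Nonempty ι] (hq : ∀ σ v, q σ v ∈ stdSimplex ℝ S) :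
    singleSite q ∈ rowStochastic ℝ (ι → S) := by
  refine mem_rowStochastic.2 ⟨fun σ τ => ?_, funext fun σ => ?_⟩
  · have (v : ι) (c : S) : 0 ≤ q σ v c := (hq σ v).1 c
    simp only [singleSite, of_apply]
    exact mul_nonneg (by positivity) <| Finset.sum_nonneg fun v _ => Finset.sum_nonneg fun c _ =>
      ite_nonneg (this v c) le_rfl
  · rw [singleSite_mulVec_apply]
    simp [dotProduct, (hq σ _).2]

lemma singleSite_mulVec_apply_mono (hq : ∀ σ v c, 0 ≤ q σ v c) {f g : (ι → S) → ℝ} {σ : ι → S}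
    (hfg : ∀ v c, f (update σ v c) ≤ g (update σ v c)) :
    (singleSite q *ᵥ f) σ ≤ (singleSite q *ᵥ g) σ := by
  rw [singleSite_mulVec_apply, singleSite_mulVec_apply]
  gcongr with v
  exact Finset.sum_le_sum fun c _ => mul_le_mul_of_nonneg_left (hfg v c) (hq σ v c)

lemma singleSite_row_congr {q' : (ι → S) → ι → S → ℝ} {σ : ι → S} (h : ∀ v, q σ v = q' σ v) :
    singleSite q σ = singleSite q' σ := by
  ext τ
  simp only [singleSite, of_apply, h]

/-- Dobrushin's criterion; the factor `2` makes `θ` a bound in total variation. -/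
lemma HasOscillation.singleSite_mulVec [Nonempty ι] (hq : ∀ σ v, q σ v ∈ stdSimplex ℝ S)
    (hlocal : ∀ σ w a, q (update σ w a) w = q σ w) {θ : ℝ}
    (hinfl : ∀ σ v w a, v ≠ w → ∑ c, |q (update σ w a) v c - q σ v c| ≤ 2 * θ)
    {α : ℝ} {h : (ι → S) → ℝ} (hh : HasOscillation α h) :
    HasOscillation ((1 - 1 / (Fintype.card ι : ℝ)) * (1 + θ) * α) (singleSite q *ᵥ h) := by
  intro σ w a
  have hα : 0 ≤ α := (abs_nonneg _).trans (hh σ w a)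
  set σ' := update σ w a with hσ'
  have hsame : (q σ' w ⬝ᵥ fun c => h (update σ' w c)) = q σ w ⬝ᵥ fun c => h (update σ w c) := by
    simp only [hσ', hlocal, update_idem]
  have hother (v : ι) (hvw : v ≠ w) : |(q σ' v ⬝ᵥ fun c => h (update σ' v c)) -
      q σ v ⬝ᵥ fun c => h (update σ v c)| ≤ (1 + θ) * α :=
    abs_dotProduct_sub_dotProduct_le hα (hq _ _) (hq _ _) (hinfl σ v w a hvw)
      (fun c d => by simpa using hh (update σ v d) v c)
      (fun c => by rw [hσ', update_comm hvw.symm]; exact hh _ _ _)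
  have hcard : ((Finset.univ.erase w).card : ℝ) = Fintype.card ι - 1 := by
    rw [Finset.cast_card_erase_of_mem (Finset.mem_univ w), Finset.card_univ]
  rw [singleSite_mulVec_apply, singleSite_mulVec_apply, ← mul_sub, ← Finset.sum_sub_distrib,
    ← Finset.add_sum_erase _ _ (Finset.mem_univ w), hsame, sub_self, zero_add, abs_mul,
    abs_of_nonneg (by positivity : 0 ≤ 1 / (Fintype.card ι : ℝ))]
  calc _ ≤ 1 / (Fintype.card ι : ℝ) * ((Fintype.card ι - 1) * ((1 + θ) * α)) := by
        rw [← hcard, ← nsmul_eq_mul]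
        gcongr
        exact (Finset.abs_sum_le_sum_abs _ _).trans
          (Finset.sum_le_card_nsmul _ _ _ fun v hv => hother v (Finset.ne_of_mem_erase hv))
    _ = (1 - 1 / (Fintype.card ι : ℝ)) * (1 + θ) * α := by field_simp

lemma abs_singleSite_pow_mulVec_sub_le [Nonempty ι] (hq : ∀ σ v, q σ v ∈ stdSimplex ℝ S)
    (hlocal : ∀ σ w a, q (update σ w a) w = q σ w) {θ : ℝ}
    (hinfl : ∀ σ v w a, v ≠ w → ∑ c, |q (update σ w a) v c - q σ v c| ≤ 2 * θ)
    {f : (ι → S) → ℝ} (hf : ∀ σ, |f σ| ≤ 1) (k : ℕ) (σ τ : ι → S) :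
    |(singleSite q ^ k *ᵥ f) σ - (singleSite q ^ k *ᵥ f) τ| ≤
      2 * Fintype.card ι * ((1 - 1 / (Fintype.card ι : ℝ)) * (1 + θ)) ^ k := by
  have hosc : HasOscillation (((1 - 1 / (Fintype.card ι : ℝ)) * (1 + θ)) ^ k * 2)
      (singleSite q ^ k *ᵥ f) := by
    induction k with
    | zero =>
      intro σ w a
      simpa using (abs_sub _ _).trans (by linarith [hf σ, hf (update σ w a)])
    | succ k ih =>
      rw [pow_succ', pow_succ', ← mulVec_mulVec, mul_assoc]
      exact ih.singleSite_mulVec hq hlocal hinfl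
  exact (hosc.abs_sub_le τ σ).trans_eq (by ring)

end SingleSite

section Glauber

variable {M : ℕ} (μ : Config M → ℝ)

lemma glauber_eq_singleSite : glauber μ = singleSite (condProb μ) := by
  ext σ τ
  simp [glauber, singleSite]

lemma condProb_mem_stdSimplex {μ : Config M → ℝ} (hμ : ∀ σ, 0 < μ σ) (σ : Config M) (v : Fin M) :
    condProb μ σ v ∈ stdSimplex ℝ (Fin 3) := by
  have hsum : 0 < ∑ b, μ (update σ v b) := Finset.sum_pos (fun b _ => hμ _) Finset.univ_nonempty
  refine ⟨fun c => div_nonneg (hμ _).le hsum.le, ?_⟩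
  simp only [condProb, ← Finset.sum_div, div_self hsum.ne']

lemma glauber_mem_rowStochastic [NeZero M] {μ : Config M → ℝ} (hμ : ∀ σ, 0 < μ σ) :
    glauber μ ∈ rowStochastic ℝ (Config M) :=
  glauber_eq_singleSite μ ▸ singleSite_mem_rowStochastic (condProb_mem_stdSimplex hμ)

lemma glauber_mulVec_apply_mono {μ : Config M → ℝ} (hμ : ∀ σ, 0 < μ σ) {f g : Config M → ℝ}
    {σ : Config M} (hfg : ∀ v c, f (update σ v c) ≤ g (update σ v c)) :
    (glauber μ *ᵥ f) σ ≤ (glauber μ *ᵥ g) σ :=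
  glauber_eq_singleSite μ ▸
    singleSite_mulVec_apply_mono (fun σ v => (condProb_mem_stdSimplex hμ σ v).1) hfg

lemma glauber_apply (σ τ : Config M) : glauber μ σ τ =
    1 / (M : ℝ) * ∑ v, if update σ v (τ v) = τ then condProb μ σ v (τ v) else 0 := by
  simp only [glauber, of_apply]
  congr! 2 with v
  refine Finset.sum_eq_single_of_mem _ (Finset.mem_univ _) fun c _ hc => if_neg fun h => hc ?_
  rw [← h, update_self]

lemma mul_glauber_comm (σ τ : Config M) : μ σ * glauber μ σ τ = μ τ * glauber μ τ σ := by
  simp only [glauber_apply, mul_left_comm (μ _), Finset.mul_sum]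
  congr! 2 with v
  have hiff : update σ v (τ v) = τ ↔ update τ v (σ v) = σ := by
    rw [update_eq_iff, update_eq_iff]
    simp [eq_comm]
  by_cases h : update σ v (τ v) = τ
  · have hother (b : Fin 3) : update σ v b = update τ v b := by rw [← h, update_idem]
    simp only [h, hiff.1 h, if_true, condProb, hother]
    ring
  · simp only [h, mt hiff.2 h, if_false, mul_zero]

lemma vecMul_glauber [NeZero M] {μ : Config M → ℝ} (hμ : ∀ σ, 0 < μ σ) : μ ᵥ* glauber μ = μ := by
  ext τ
  simp only [vecMul, dotProduct, mul_glauber_comm μ _ τ, ← Finset.mul_sum,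
    sum_row_of_mem_rowStochastic (glauber_mem_rowStochastic hμ), mul_one]

end Glauber

section Softmax

variable {S : Type*} [Fintype S]

/-- The probability vector on `S` with weights proportional to `exp (x c)`. -/
def softmax (x : S → ℝ) (c : S) : ℝ := exp (x c) / ∑ b, exp (x b)

lemma softmax_mem_stdSimplex [Nonempty S] (x : S → ℝ) : softmax x ∈ stdSimplex ℝ S := by
  refine ⟨fun c => by unfold softmax; positivity, ?_⟩
  have : 0 < ∑ b, exp (x b) := Finset.sum_pos (fun b _ => exp_pos _) Finset.univ_nonempty
  simp only [softmax, ← Finset.sum_div, div_self this.ne']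

lemma hasDerivAt_softmax_line (x d : S → ℝ) (a : S) (t : ℝ) :
    HasDerivAt (fun t : ℝ => softmax (x + t • d) a)
      (softmax (x + t • d) a * (d a - softmax (x + t • d) ⬝ᵥ d)) t := by
  have hexp (b : S) : HasDerivAt (fun t : ℝ => exp ((x + t • d) b))
      (exp ((x + t • d) b) * d b) t := by
    simpa using (((hasDerivAt_id t).mul_const (d b)).const_add (x b)).exp
  have hpos : 0 < ∑ b, exp ((x + t • d) b) := Finset.sum_pos (fun b _ => exp_pos _) ⟨a, by simp⟩
  refine ((hexp a).fun_div (HasDerivAt.fun_sum fun b _ => hexp b) hpos.ne').congr_deriv ?_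
  simp only [softmax, dotProduct, div_mul_eq_mul_div, ← Finset.sum_div]
  field_simp

lemma exists_softmax_sub_eq (x y : S → ℝ) (a : S) : ∃ t ∈ Set.Ioo (0 : ℝ) 1,
    softmax y a - softmax x a = softmax (x + t • (y - x)) a *
      ((y - x) a - softmax (x + t • (y - x)) ⬝ᵥ (y - x)) := by
  obtain ⟨t, ht, hslope⟩ := exists_hasDerivAt_eq_slope (fun t : ℝ => softmax (x + t • (y - x)) a) _
    zero_lt_one
    (fun t _ => (hasDerivAt_softmax_line x (y - x) a t).continuousAt.continuousWithinAt)
    fun t _ => hasDerivAt_softmax_line x (y - x) a t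
  exact ⟨t, ht, by simpa using hslope.symm⟩

lemma abs_softmax_sub_le {x y : S → ℝ} {δ : ℝ} (hxy : ∀ c, |(y - x) c| ≤ δ) (a : S) :
    |softmax y a - softmax x a| ≤ 2 * δ := by
  obtain ⟨t, -, hmvt⟩ := exists_softmax_sub_eq x y a
  have : Nonempty S := ⟨a⟩
  have hsimplex := softmax_mem_stdSimplex (x + t • (y - x))
  have hmean := abs_dotProduct_le_of_mem_stdSimplex hsimplex hxy
  rw [hmvt, abs_mul, abs_of_nonneg (hsimplex.1 a)]
  refine (mul_le_of_le_one_left (abs_nonneg _) (mem_Icc_of_mem_stdSimplex hsimplex a).2).trans ?_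
  exact (abs_sub _ _).trans (by linarith [hxy a])

end Softmax

section Ratio

variable {M : ℕ}

lemma ratio_nonneg (σ : Config M) (c : Fin 3) : 0 ≤ ratio σ c := by
  unfold ratio; positivity

lemma ratio_eq_sum_single_div (σ : Config M) (c : Fin 3) :
    ratio σ c = (∑ l, (Pi.single (σ l) 1 : Fin 3 → ℝ) c) / M := by
  simp [ratio, Pi.single_apply, eq_comm]

lemma sum_ratio [NeZero M] (σ : Config M) : ∑ c, ratio σ c = 1 := by
  simp only [ratio_eq_sum_single_div, ← Finset.sum_div]
  rw [Finset.sum_comm]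
  simp

lemma ratio_mem_stdSimplex [NeZero M] (σ : Config M) : ratio σ ∈ stdSimplex ℝ (Fin 3) :=
  ⟨ratio_nonneg σ, sum_ratio σ⟩

/-- The contribution to the colour ratios of all spins except the one at `v`, still normalised by
the total number `M` of spins. -/
def othersRatio (σ : Config M) (v : Fin M) : Fin 3 → ℝ := ratio σ - Pi.single (σ v) (1 / (M : ℝ))

lemma othersRatio_update_self (σ : Config M) (v : Fin M) (a : Fin 3) :
    othersRatio (update σ v a) v = othersRatio σ v := by
  have hsum (τ : Config M) : othersRatio τ v =
      (1 / (M : ℝ)) • ∑ l ∈ Finset.univ.erase v, Pi.single (τ l) 1 := by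
    ext c
    rw [othersRatio, Pi.sub_apply, ratio_eq_sum_single_div,
      ← Finset.add_sum_erase _ _ (Finset.mem_univ v), Pi.smul_apply, Finset.sum_apply, smul_eq_mul]
    simp only [Pi.single_apply]
    split_ifs <;> ring
  rw [hsum, hsum]
  congr! 3 with l hl
  rw [update_of_ne (Finset.ne_of_mem_erase hl)]

lemma ratio_update (σ : Config M) (v : Fin M) (a : Fin 3) :
    ratio (update σ v a) = othersRatio σ v + Pi.single a (1 / (M : ℝ)) := by
  rw [← othersRatio_update_self σ v a, othersRatio, update_self, sub_add_cancel]

lemma othersRatio_update_of_ne (σ : Config M) {v w : Fin M} (h : v ≠ w) (a : Fin 3) :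
    othersRatio (update σ w a) v =
      othersRatio σ v + (Pi.single a (1 / (M : ℝ)) - Pi.single (σ w) (1 / (M : ℝ))) := by
  rw [othersRatio, ratio_update, update_of_ne h, othersRatio, othersRatio]
  abel

lemma sum_othersRatio [NeZero M] (σ : Config M) (v : Fin M) :
    ∑ c, othersRatio σ v c = 1 - 1 / M := by
  simp [othersRatio, sum_ratio]

lemma othersRatio_mem_Icc (σ : Config M) (v : Fin M) (c : Fin 3) :
    othersRatio σ v c ∈ Set.Icc (ratio σ c - 1 / M) (ratio σ c) := by
  have : (0 : ℝ) ≤ 1 / M := by positivity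
  rw [othersRatio, Pi.sub_apply, Pi.single_apply]
  split_ifs <;> constructor <;> linarith

/-- The law of a spin resampled from the mean-field Gibbs measure with parameter `β` when the
colour ratios of the other spins are `x`. -/
def updateLaw (β : ℝ) (x : Fin 3 → ℝ) : Fin 3 → ℝ := softmax ((2 * β) • x)

lemma updateLaw_mem_stdSimplex (β : ℝ) (x : Fin 3 → ℝ) : updateLaw β x ∈ stdSimplex ℝ (Fin 3) :=
  softmax_mem_stdSimplex _

lemma gibbs_pos (β : ℝ) (σ : Config M) : 0 < gibbs β M σ :=
  div_pos (exp_pos _) (Finset.sum_pos (fun _ _ => exp_pos _) Finset.univ_nonempty)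

lemma weight_update [NeZero M] (β : ℝ) (σ : Config M) (v : Fin M) (b : Fin 3) :
    weight β (update σ v b) = exp (M * β * (∑ d, othersRatio σ v d ^ 2 + 1 / (M : ℝ) ^ 2)) *
      exp (2 * β * othersRatio σ v b) := by
  have hsq : ∑ d, ratio (update σ v b) d ^ 2 =
      ∑ d, othersRatio σ v d ^ 2 + (2 * othersRatio σ v b / M + 1 / (M : ℝ) ^ 2) := by
    simp only [ratio_update, Pi.add_apply, add_sq, Finset.sum_add_distrib, add_assoc]
    simp [Pi.single_apply]
    ring
  rw [weight, ← exp_add, hsq]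
  congr 1
  have : (M : ℝ) ≠ 0 := NeZero.ne _
  field_simp
  ring

lemma condProb_gibbs [NeZero M] (β : ℝ) (σ : Config M) (v : Fin M) :
    condProb (gibbs β M) σ v = updateLaw β (othersRatio σ v) := by
  ext c
  have hZ : (0 : ℝ) < ∑ τ : Config M, weight β τ :=
    Finset.sum_pos (fun _ _ => exp_pos _) Finset.univ_nonempty
  simp only [condProb, gibbs, ← Finset.sum_div, weight_update, ← Finset.mul_sum, updateLaw, softmax,
    Pi.smul_apply, smul_eq_mul]
  rw [div_div_div_cancel_right₀ hZ.ne', mul_div_mul_left _ _ (exp_pos _).ne']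

end Ratio

section Centre

lemma centre_mem_stdSimplex (i : Fin 4) : centre i ∈ stdSimplex ℝ (Fin 3) := by
  refine ⟨fun c => ?_, ?_⟩
  · fin_cases i <;> fin_cases c <;> norm_num [centre]
  · rw [Fin.sum_univ_three]
    fin_cases i <;> simp [centre] <;> norm_num

lemma centre_mul_one_sub_add_le (i : Fin 4) {a b : Fin 3} (hab : a ≠ b) :
    centre i a * (1 - centre i a + centre i b) ≤ 1 / 3 := by
  fin_cases i <;> fin_cases a <;> fin_cases b <;> simp [centre] at hab ⊢ <;> norm_num

lemma centre_mul_centre_le (i : Fin 4) {a b : Fin 3} (hab : a ≠ b) :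
    centre i a * centre i b ≤ 1 / 9 := by
  fin_cases i <;> fin_cases a <;> fin_cases b <;> simp [centre] at hab ⊢ <;> norm_num

lemma two_mul_criticalBeta_pos : 0 < 2 * criticalBeta := by
  have := log_pos one_lt_two
  unfold criticalBeta
  positivity

lemma two_mul_criticalBeta_lt : 2 * criticalBeta < 2.7727 := by
  linarith [log_two_lt_d9, show criticalBeta = 2 * log 2 from rfl]

lemma exists_exp_centre_eq (i : Fin 4) : ∃ K : ℝ, 0 < K ∧
    ∀ c, exp (2 * criticalBeta * centre i c) = K * centre i c := by
  have h : exp (2 * criticalBeta * (2 / 3)) = 4 * exp (2 * criticalBeta * (1 / 6)) := by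
    rw [show 2 * criticalBeta * (2 / 3) = log 2 + (log 2 + 2 * criticalBeta * (1 / 6)) by
      unfold criticalBeta; ring, exp_add, exp_add, exp_log two_pos]
    ring
  refine ⟨if i = 3 then 3 * exp (2 * criticalBeta * (1 / 3))
    else 6 * exp (2 * criticalBeta * (1 / 6)), by split_ifs <;> positivity, fun c => ?_⟩
  fin_cases i <;> fin_cases c <;> simp [centre] <;> norm_num at h ⊢ <;> linarith

lemma updateLaw_centre (i : Fin 4) : updateLaw criticalBeta (centre i) = centre i := by
  obtain ⟨K, hK, hexp⟩ := exists_exp_centre_eq i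
  ext c
  simp only [updateLaw, softmax, Pi.smul_apply, smul_eq_mul, hexp, ← Finset.mul_sum,
    (centre_mem_stdSimplex i).2]
  field_simp

lemma rho_pos : 0 < rho := by norm_num [rho]

lemma exists_updateLaw_sub_eq {i : Fin 4} {x y : Fin 3 → ℝ}
    (hx : x ∈ Metric.closedBall (centre i) (3 * rho))
    (hy : y ∈ Metric.closedBall (centre i) (3 * rho)) (a : Fin 3) :
    ∃ p ∈ stdSimplex ℝ (Fin 3), (∀ c, |p c - centre i c| ≤ 2 / 10 ^ 5) ∧
      updateLaw criticalBeta y a - updateLaw criticalBeta x a =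
        2 * criticalBeta * (p a * ((y - x) a - p ⬝ᵥ (y - x))) := by
  obtain ⟨t, ht, hmvt⟩ :=
    exists_softmax_sub_eq ((2 * criticalBeta) • x) ((2 * criticalBeta) • y) a
  set z := x + t • (y - x)
  have hz : z ∈ Metric.closedBall (centre i) (3 * rho) :=
    (convex_closedBall _ _).add_smul_sub_mem hx hy ⟨ht.1.le, ht.2.le⟩
  rw [show (2 * criticalBeta) • x + t • ((2 * criticalBeta) • y - (2 * criticalBeta) • x) =
    (2 * criticalBeta) • z by module, ← smul_sub, dotProduct_smul] at hmvt
  refine ⟨updateLaw criticalBeta z, updateLaw_mem_stdSimplex _ _, fun c => ?_, ?_⟩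
  · have hκ := two_mul_criticalBeta_lt
    calc |updateLaw criticalBeta z c - centre i c|
        = |updateLaw criticalBeta z c - updateLaw criticalBeta (centre i) c| := by
          rw [updateLaw_centre]
      _ ≤ 2 * (2 * criticalBeta * (3 * rho)) := by
          refine abs_softmax_sub_le (fun b => ?_) c
          rw [← smul_sub, Pi.smul_apply, smul_eq_mul, abs_mul, abs_of_pos two_mul_criticalBeta_pos]
          exact mul_le_mul_of_nonneg_left ((dist_pi_le_iff (by linarith [rho_pos])).1 hz b)
            two_mul_criticalBeta_pos.le
      _ ≤ 2 / 10 ^ 5 := by rw [rho]; linarith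
  · rw [updateLaw, updateLaw, hmvt]
    simp only [updateLaw, Pi.smul_apply, smul_eq_mul]
    ring

end Centre

section Clipped

variable {i : Fin 4} {x y : Fin 3 → ℝ}

lemma mul_one_sub_add_le_of_abs_sub_centre_le {p : Fin 3 → ℝ} (hp : p ∈ stdSimplex ℝ (Fin 3))
    (hpc : ∀ c, |p c - centre i c| ≤ 2 / 10 ^ 5) {a b : Fin 3} (hab : a ≠ b) :
    p a * (1 - p a + p b) ≤ 335 / 1000 := by
  have ha := abs_le.1 (hpc a)
  have hb := abs_le.1 (hpc b)
  have hpa := (mem_Icc_of_mem_stdSimplex hp a).2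
  have hCa := mem_Icc_of_mem_stdSimplex (centre_mem_stdSimplex i) a
  have hCb := mem_Icc_of_mem_stdSimplex (centre_mem_stdSimplex i) b
  calc p a * (1 - p a + p b)
      ≤ (centre i a + 2 / 10 ^ 5) * (1 - centre i a + centre i b + 4 / 10 ^ 5) :=
        mul_le_mul (by linarith) (by linarith) (by linarith [hp.1 b]) (by linarith [hCa.1])
    _ ≤ 335 / 1000 := by
        linarith [hCa.2, hCb.2, hCa.1, centre_mul_one_sub_add_le i hab]

lemma mul_le_of_abs_sub_centre_le {p : Fin 3 → ℝ} (hp : p ∈ stdSimplex ℝ (Fin 3))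
    (hpc : ∀ c, |p c - centre i c| ≤ 2 / 10 ^ 5) {a b : Fin 3} (hab : a ≠ b) :
    p a * p b ≤ 1125 / 10000 := by
  have ha := abs_le.1 (hpc a)
  have hb := abs_le.1 (hpc b)
  have hCa := mem_Icc_of_mem_stdSimplex (centre_mem_stdSimplex i) a
  have hCb := mem_Icc_of_mem_stdSimplex (centre_mem_stdSimplex i) b
  calc p a * p b ≤ (centre i a + 2 / 10 ^ 5) * (centre i b + 2 / 10 ^ 5) :=
        mul_le_mul (by linarith) (by linarith) (hp.1 b) (by linarith [hCa.1])
    _ ≤ 1125 / 10000 := by linarith [centre_mul_centre_le i hab, hCa.2, hCb.2]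

lemma updateLaw_sub_mem_Icc (hx : x ∈ Metric.closedBall (centre i) (3 * rho))
    (hy : y ∈ Metric.closedBall (centre i) (3 * rho)) {a b : Fin 3} (hab : a ≠ b) {t : ℝ}
    (ha : (y - x) a ∈ Set.Icc 0 t) (hb : (x - y) b ∈ Set.Icc 0 t)
    (hc : ∀ c, c ≠ a → c ≠ b → y c = x c) :
    updateLaw criticalBeta y a - updateLaw criticalBeta x a ∈ Set.Icc 0 (93 / 100 * t) := by
  obtain ⟨p, hp, hpc, heq⟩ := exists_updateLaw_sub_eq hx hy a
  have hdot : p ⬝ᵥ (y - x) = p a * (y - x) a - p b * (x - y) b := by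
    rw [dotProduct, Fintype.sum_eq_add a b hab fun c hc' => by simp [hc c hc'.1 hc'.2]]
    simp only [Pi.sub_apply]
    ring
  have hsplit : p a * ((y - x) a - p ⬝ᵥ (y - x)) =
      p a * (1 - p a) * (y - x) a + p a * p b * (x - y) b := by rw [hdot]; ring
  have hpa := hp.1 a
  have hpb := hp.1 b
  have hpa1 : 0 ≤ 1 - p a := sub_nonneg.2 (mem_Icc_of_mem_stdSimplex hp a).2
  rw [heq, hsplit]
  have hκ := two_mul_criticalBeta_pos
  refine ⟨?_, ?_⟩
  · have := ha.1
    have := hb.1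
    positivity
  · calc 2 * criticalBeta * (p a * (1 - p a) * (y - x) a + p a * p b * (x - y) b)
        ≤ 2 * criticalBeta * (p a * (1 - p a) * t + p a * p b * t) := by
          gcongr
          exacts [ha.2, hb.2]
      _ = 2 * criticalBeta * (p a * (1 - p a + p b)) * t := by ring
      _ ≤ 2.7727 * (335 / 1000) * t := by
          have := ha.1.trans ha.2
          gcongr
          · exact two_mul_criticalBeta_lt.le
          · exact mul_one_sub_add_le_of_abs_sub_centre_le hp hpc hab
      _ ≤ 93 / 100 * t := by linarith [ha.1.trans ha.2]

lemma sum_abs_le_of_sum_eq_zero {D : Fin 3 → ℝ} (hD : ∑ c, D c = 0) {a b : Fin 3} (hab : a ≠ b)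
    {r : ℝ} (ha : D a ∈ Set.Icc 0 r) (hb : -D b ∈ Set.Icc 0 r) : ∑ c, |D c| ≤ 2 * r := by
  obtain ⟨ha0, har⟩ := ha
  obtain ⟨hb0, hbr⟩ := hb
  rw [Fin.sum_univ_three] at hD ⊢
  fin_cases a <;> fin_cases b <;> grind

lemma sum_abs_updateLaw_sub_le (hx : x ∈ Metric.closedBall (centre i) (3 * rho))
    (hy : y ∈ Metric.closedBall (centre i) (3 * rho)) {a b : Fin 3} (hab : a ≠ b) {t : ℝ}
    (ha : (y - x) a ∈ Set.Icc 0 t) (hb : (x - y) b ∈ Set.Icc 0 t)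
    (hc : ∀ c, c ≠ a → c ≠ b → y c = x c) :
    ∑ c, |updateLaw criticalBeta y c - updateLaw criticalBeta x c| ≤ 2 * (93 / 100 * t) := by
  refine sum_abs_le_of_sum_eq_zero ?_ hab (updateLaw_sub_mem_Icc hx hy hab ha hb hc) ?_
  · rw [Finset.sum_sub_distrib, (updateLaw_mem_stdSimplex _ _).2, (updateLaw_mem_stdSimplex _ _).2,
      sub_self]
  · rw [neg_sub]
    exact updateLaw_sub_mem_Icc hy hx hab.symm hb ha fun c hca hcb => (hc c hcb hca).symm

lemma centre_sub_le_centre_add (i : Fin 4) (c : Fin 3) :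
    centre i c - 3 * rho ≤ centre i c + 3 * rho := by linarith [rho_pos]

/-- Coordinatewise truncation to the box of radius `3 ρ` around the `i`-th centre. -/
def clip (i : Fin 4) (x : Fin 3 → ℝ) (c : Fin 3) : ℝ :=
  Set.projIcc _ _ (centre_sub_le_centre_add i c) (x c)

lemma clip_mem_closedBall (i : Fin 4) (x : Fin 3 → ℝ) :
    clip i x ∈ Metric.closedBall (centre i) (3 * rho) := by
  rw [mem_closedBall_iff_norm, pi_norm_le_iff_of_nonneg (by linarith [rho_pos])]
  intro c
  have := (Set.projIcc _ _ (centre_sub_le_centre_add i c) (x c)).2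
  rw [Pi.sub_apply, norm_eq_abs, abs_le, clip]
  constructor <;> linarith [this.1, this.2]

lemma clip_eq_self (hx : x ∈ Metric.closedBall (centre i) (3 * rho)) : clip i x = x := by
  rw [mem_closedBall_iff_norm, pi_norm_le_iff_of_nonneg (by linarith [rho_pos])] at hx
  ext c
  have := abs_le.1 (hx c)
  rw [Pi.sub_apply] at this
  rw [clip, Set.projIcc_of_mem _ ⟨by linarith [this.1], by linarith [this.2]⟩]

lemma clip_sub_clip_mem_Icc {c : Fin 3} {t : ℝ} (h : (y - x) c ∈ Set.Icc 0 t) :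
    (clip i y - clip i x) c ∈ Set.Icc 0 t := by
  refine ⟨sub_nonneg.2 (Set.monotone_projIcc _ (sub_nonneg.1 h.1)), ?_⟩
  refine (le_abs_self _).trans ((Set.abs_projIcc_sub_projIcc _).trans ?_)
  rw [← Pi.sub_apply, abs_of_nonneg h.1]
  exact h.2

variable {M : ℕ}

/-- The update rule of the Glauber dynamics at the critical parameter, with the colour ratios
truncated to a box around the `i`-th centre. It contracts everywhere, and it agrees with the
original rule as long as the colour ratios are close to the centre. -/
def clippedProb (i : Fin 4) (σ : Config M) (v : Fin M) : Fin 3 → ℝ :=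
  updateLaw criticalBeta (clip i (othersRatio σ v))

lemma clippedProb_mem_stdSimplex (i : Fin 4) (σ : Config M) (v : Fin M) :
    clippedProb i σ v ∈ stdSimplex ℝ (Fin 3) :=
  updateLaw_mem_stdSimplex _ _

lemma sum_abs_clippedProb_update_sub_le (i : Fin 4) (σ : Config M) {v w : Fin M} (hvw : v ≠ w)
    (a : Fin 3) :
    ∑ c, |clippedProb i (update σ w a) v c - clippedProb i σ v c| ≤
      2 * (93 / 100 * (1 / (M : ℝ))) := by
  have hmove := othersRatio_update_of_ne σ hvw a
  rcases eq_or_ne a (σ w) with rfl | ha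
  · rw [update_eq_self]
    simp only [sub_self, abs_zero, Finset.sum_const_zero]
    positivity
  refine sum_abs_updateLaw_sub_le (clip_mem_closedBall i _) (clip_mem_closedBall i _) ha
    (clip_sub_clip_mem_Icc ?_) (clip_sub_clip_mem_Icc ?_) fun c hca hcb => ?_
  · simp [hmove, ha]
  · simp [hmove, ha.symm]
  · simp [clip, hmove, hca, hcb]

lemma abs_clipped_pow_mulVec_sub_le [NeZero M] (i : Fin 4) {f : Config M → ℝ}
    (hf : ∀ σ, |f σ| ≤ 1) (k : ℕ) (σ τ : Config M) :
    |(singleSite (clippedProb i) ^ k *ᵥ f) σ - (singleSite (clippedProb i) ^ k *ᵥ f) τ| ≤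
      2 * (M * (1 - 7 / 100 / M) ^ k) := by
  have hM : (1 : ℝ) ≤ M := by exact_mod_cast NeZero.one_le
  have hM' : 1 / (M : ℝ) ≤ 1 := (div_le_one (by positivity)).2 hM
  refine (abs_singleSite_pow_mulVec_sub_le (clippedProb_mem_stdSimplex i)
    (fun σ w a => by rw [clippedProb, othersRatio_update_self, clippedProb])
    (fun σ v w a hvw => sum_abs_clippedProb_update_sub_le i σ hvw a) hf k σ τ).trans ?_
  rw [Fintype.card_fin, mul_assoc]
  have hrate : (1 - 1 / (M : ℝ)) * (1 + 93 / 100 * (1 / M)) ≤ 1 - 7 / 100 / M := by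
    rw [div_eq_mul_one_div (7 / 100 : ℝ)]
    nlinarith [sq_nonneg (1 / (M : ℝ))]
  have : 0 ≤ (1 - 1 / (M : ℝ)) * (1 + 93 / 100 * (1 / M)) :=
    mul_nonneg (by linarith) (by positivity)
  gcongr

end Clipped

section Core

variable {M : ℕ} {i : Fin 4} {σ : Config M}

/-- The configurations whose colour ratios lie in the triangle `{s | ∀ c, C_{i,c} - ρ ≤ s_c}`
around the `i`-th centre. -/
def core (M : ℕ) (i : Fin 4) : Set (Config M) := {σ | ∀ c, centre i c - rho ≤ ratio σ c}

lemma abs_sub_le_of_forall_sub_le {p y : Fin 3 → ℝ} {r : ℝ} (hp : ∑ c, p c = ∑ c, y c)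
    (h : ∀ c, p c - r ≤ y c) (c : Fin 3) : |y c - p c| ≤ 2 * r := by
  have h0 := h 0
  have h1 := h 1
  have h2 := h 2
  simp only [Fin.sum_univ_three] at hp
  rw [abs_le]
  fin_cases c <;> simp only [Fin.zero_eta, Fin.mk_one, Fin.reduceFinMk] <;>
    constructor <;> linarith

lemma abs_ratio_sub_centre_le [NeZero M] (h : σ ∈ core M i) (c : Fin 3) :
    |ratio σ c - centre i c| ≤ 2 * rho :=
  abs_sub_le_of_forall_sub_le ((centre_mem_stdSimplex i).2.trans (sum_ratio σ).symm) h c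

lemma othersRatio_mem_closedBall [NeZero M] (hM : 1 / (M : ℝ) ≤ rho / 1000) (h : σ ∈ core M i)
    (v : Fin M) : othersRatio σ v ∈ Metric.closedBall (centre i) (3 * rho) := by
  rw [mem_closedBall_iff_norm, pi_norm_le_iff_of_nonneg (by linarith [rho_pos])]
  intro c
  have hc := abs_le.1 (abs_ratio_sub_centre_le h c)
  have hv := othersRatio_mem_Icc σ v c
  rw [Pi.sub_apply, norm_eq_abs, abs_le]
  constructor <;> linarith [hv.1, hv.2, hc.1, hc.2, rho_pos]

lemma condProb_gibbs_eq_clippedProb [NeZero M] (hM : 1 / (M : ℝ) ≤ rho / 1000)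
    (h : σ ∈ core M i) (v : Fin M) :
    condProb (gibbs criticalBeta M) σ v = clippedProb i σ v := by
  rw [condProb_gibbs, clippedProb, clip_eq_self (othersRatio_mem_closedBall hM h v)]

lemma glauber_eq_clipped [NeZero M] (hM : 1 / (M : ℝ) ≤ rho / 1000) (h : σ ∈ core M i) :
    glauber (gibbs criticalBeta M) σ = singleSite (clippedProb i) σ := by
  rw [glauber_eq_singleSite]
  exact singleSite_row_congr (condProb_gibbs_eq_clippedProb hM h)

lemma mul_dotProduct_sub_le {S : Type*} [Fintype S] {p w : S → ℝ} (hp : p ∈ stdSimplex ℝ S)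
    (hw : ∀ b, 0 ≤ w b) {r : ℝ} (hr : 0 ≤ r) {c : S} (hcross : ∀ b ≠ c, p c * p b ≤ r) :
    p c * (p ⬝ᵥ w - w c) ≤ r * ∑ b, w b := by
  classical
  calc p c * (p ⬝ᵥ w - w c) = ∑ b, p c * (p b * w b - if b = c then w b else 0) := by
        rw [← Finset.mul_sum, Finset.sum_sub_distrib, Finset.sum_ite_eq' _ c,
          if_pos (Finset.mem_univ c), dotProduct]
    _ ≤ r * ∑ b, w b := by
        rw [Finset.mul_sum]
        refine Finset.sum_le_sum fun b _ => ?_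
        split_ifs with hbc
        · have := mul_nonneg (mul_nonneg (hp.1 c)
            (sub_nonneg.2 (mem_Icc_of_mem_stdSimplex hp b).2)) (hw b)
          linarith [mul_nonneg hr (hw b)]
        · rw [sub_zero, ← mul_assoc]
          exact mul_le_mul_of_nonneg_right (hcross b hbc) (hw b)

lemma sub_le_updateLaw {x : Fin 3 → ℝ} (hx : x ∈ Metric.closedBall (centre i) (3 * rho)) {m : ℝ}
    (hm : ∀ b, centre i b - m ≤ x b) (hsum : ∑ b, x b ≤ 1) (c : Fin 3) :
    centre i c - 936 / 1000 * m ≤ updateLaw criticalBeta x c := by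
  obtain ⟨p, hp, hpc, heq⟩ :=
    exists_updateLaw_sub_eq (Metric.mem_closedBall_self (by linarith [rho_pos])) hx c
  set w : Fin 3 → ℝ := fun b => x b - centre i b + m
  have hw (b : Fin 3) : 0 ≤ w b := by linarith [hm b]
  have hwsum : ∑ b, w b ≤ 3 * m := by
    simp only [w, Finset.sum_add_distrib, Finset.sum_sub_distrib, (centre_mem_stdSimplex i).2,
      Finset.sum_const, Finset.card_univ, Fintype.card_fin, nsmul_eq_mul, Nat.cast_ofNat]
    linarith
  have hshift : (x - centre i) c - p ⬝ᵥ (x - centre i) = w c - p ⬝ᵥ w := by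
    have : w = (x - centre i) + fun _ => m := rfl
    rw [this, dotProduct_add, Pi.add_apply]
    simp only [dotProduct, ← Finset.sum_mul, hp.2]
    ring
  have hdot : p c * (p ⬝ᵥ w - w c) ≤ 1125 / 10000 * (3 * m) :=
    (mul_dotProduct_sub_le hp hw (by norm_num) fun b hb =>
      mul_le_of_abs_sub_centre_le hp hpc (Ne.symm hb)).trans (by linarith)
  have hm0 : 0 ≤ m := by linarith [Finset.sum_nonneg fun b (_ : b ∈ Finset.univ) => hw b]
  rw [updateLaw_centre, hshift] at heq
  nlinarith [two_mul_criticalBeta_lt, two_mul_criticalBeta_pos]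

lemma centre_sub_le_condProb [NeZero M] (hM : 1 / (M : ℝ) ≤ rho / 1000) (h : σ ∈ core M i)
    (v : Fin M) (c : Fin 3) :
    centre i c - 94 / 100 * rho ≤ condProb (gibbs criticalBeta M) σ v c := by
  rw [condProb_gibbs]
  have hM' : (0 : ℝ) ≤ 1 / M := by positivity
  have := sub_le_updateLaw (othersRatio_mem_closedBall hM h v) (m := 1001 / 1000 * rho)
    (fun b => by linarith [h b, (othersRatio_mem_Icc σ v b).1])
    (by rw [sum_othersRatio]; linarith) c
  linarith [rho_pos]

end Core

section Lyapunov

variable {M : ℕ} {i : Fin 4} {σ : Config M}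

/-- The base of the exponential Lyapunov functions. It is so close to `1` that the drift of the
colour ratios dominates the second-order terms. -/
def lyapBase : ℝ := 1 + rho / 100

/-- The exponential Lyapunov function controlling the exit from the core through the side
`s_c = C_{i,c} - ρ` of the triangle. -/
def lyap (i : Fin 4) (c : Fin 3) (σ : Config M) : ℝ :=
  lyapBase ^ (M * (centre i c - rho - ratio σ c))

/-- The exponential rate at which the probability of an exit from the core decays. -/
def exitRate : ℝ := log lyapBase * (3 / 100 * rho)

lemma one_lt_lyapBase : 1 < lyapBase := by norm_num [lyapBase, rho]

lemma lyapBase_pos : 0 < lyapBase := one_pos.trans one_lt_lyapBase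

lemma exitRate_pos : 0 < exitRate :=
  mul_pos (log_pos one_lt_lyapBase) (by linarith [rho_pos])

lemma lyap_pos (i : Fin 4) (c : Fin 3) (σ : Config M) : 0 < lyap i c σ :=
  rpow_pos_of_pos lyapBase_pos _

lemma lyap_update [NeZero M] (i : Fin 4) (c : Fin 3) (σ : Config M) (v : Fin M) (b : Fin 3) :
    lyap i c (update σ v b) =
      lyap i c σ * (if σ v = c then lyapBase else 1) * (if b = c then lyapBase⁻¹ else 1) := by
  have hM : (M : ℝ) * (1 / M) = 1 := mul_one_div_cancel (NeZero.ne _)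
  have hexp : M * (centre i c - rho - ratio (update σ v b) c) =
      M * (centre i c - rho - ratio σ c) + (if σ v = c then 1 else 0) +
        (if b = c then -1 else 0) := by
    simp only [ratio_update, othersRatio, Pi.add_apply, Pi.sub_apply, Pi.single_apply,
      @eq_comm _ c]
    split_ifs <;> linarith
  rw [lyap, hexp, rpow_add lyapBase_pos, rpow_add lyapBase_pos, lyap]
  simp only [apply_ite (lyapBase ^ · : ℝ → ℝ), rpow_one, rpow_zero, rpow_neg_one]

lemma lyap_le_exp (h : centre i c - 97 / 100 * rho ≤ ratio σ c) :
    lyap i c σ ≤ exp (-(exitRate * M)) := by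
  rw [lyap, rpow_def_of_pos lyapBase_pos, exp_le_exp, exitRate]
  have hM : M * (centre i c - rho - ratio σ c) ≤ M * -(3 / 100 * rho) := by gcongr; linarith
  linarith [mul_le_mul_of_nonneg_left hM (log_pos one_lt_lyapBase).le]

lemma dotProduct_ite_eq_inv {S : Type*} [Fintype S] [DecidableEq S] {p : S → ℝ}
    (hp : p ∈ stdSimplex ℝ S) (c : S) (a : ℝ) :
    (p ⬝ᵥ fun b => if b = c then a else 1) = 1 - p c * (1 - a) := by
  have (b : S) : p b * (if b = c then a else 1) = p b - if b = c then p b * (1 - a) else 0 := by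
    split_ifs <;> ring
  simp only [dotProduct, this, Finset.sum_sub_distrib, hp.2, Finset.sum_ite_eq', Finset.mem_univ,
    if_true]

lemma sum_ite_eq_ratio [NeZero M] (σ : Config M) (c : Fin 3) (a : ℝ) :
    (1 / (M : ℝ)) * ∑ v, (if σ v = c then a else 1) = 1 + ratio σ c * (a - 1) := by
  have (v : Fin M) : (if σ v = c then a else 1) = 1 + (if σ v = c then 1 else 0) * (a - 1) := by
    split_ifs <;> ring
  simp only [this, Finset.sum_add_distrib, ← Finset.sum_mul, Finset.sum_boole, ratio,
    Finset.sum_const, Finset.card_univ, Fintype.card_fin, nsmul_eq_mul, mul_one]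
  have : (M : ℝ) ≠ 0 := NeZero.ne _
  field_simp

/-- The factor by which one resampling step multiplies `lyap` on average when the colour has ratio
`s` and is chosen with probability `q`. -/
lemma drift_factor_le_one {a s q : ℝ} (ha : 1 ≤ a) (hs : s ∈ Set.Icc 0 1) (hq : q ∈ Set.Icc 0 1)
    (hsq : s + (a - 1) ≤ q) : (1 + s * (a - 1)) * (1 - q * (1 - a⁻¹)) ≤ 1 := by
  have hsq' : s * (1 - q) ≤ 1 := mul_le_one₀ hs.2 (sub_nonneg.2 hq.2) (by linarith [hq.1])
  have hnum : (1 + s * (a - 1)) * (a - q * (a - 1)) ≤ a := by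
    nlinarith [mul_nonneg (sub_nonneg.2 ha) (sub_nonneg.2 hsq),
      mul_nonneg (mul_nonneg (sub_nonneg.2 ha) (sub_nonneg.2 ha)) (sub_nonneg.2 hsq')]
  have ha0 : 0 < a := by linarith
  calc (1 + s * (a - 1)) * (1 - q * (1 - a⁻¹))
      = (1 + s * (a - 1)) * (a - q * (a - 1)) / a := by field_simp
    _ ≤ 1 := (div_le_one ha0).2 hnum

lemma condProb_dotProduct_lyap_update [NeZero M] (i : Fin 4) (c : Fin 3) (σ : Config M)
    (v : Fin M) :
    (condProb (gibbs criticalBeta M) σ v ⬝ᵥ fun b => lyap i c (update σ v b)) =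
      lyap i c σ * (if σ v = c then lyapBase else 1) *
        (1 - condProb (gibbs criticalBeta M) σ v c * (1 - lyapBase⁻¹)) := by
  rw [← dotProduct_ite_eq_inv (condProb_mem_stdSimplex (gibbs_pos _) σ v), ← smul_eq_mul,
    ← dotProduct_smul]
  congr 1
  ext b
  rw [lyap_update, Pi.smul_apply, smul_eq_mul]

lemma glauber_mulVec_lyap_le_mul [NeZero M] {q : ℝ} {c : Fin 3}
    (hq : ∀ v, q ≤ condProb (gibbs criticalBeta M) σ v c) (i : Fin 4) :
    (glauber (gibbs criticalBeta M) *ᵥ lyap i c) σ ≤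
      lyap i c σ * ((1 + ratio σ c * (lyapBase - 1)) * (1 - q * (1 - lyapBase⁻¹))) := by
  have hinv : 0 ≤ 1 - lyapBase⁻¹ := sub_nonneg.2 (inv_le_one_of_one_le₀ one_lt_lyapBase.le)
  have hlyap (v : Fin M) : 0 ≤ lyap i c σ * (if σ v = c then lyapBase else 1) := by
    have := lyap_pos i c σ
    have := lyapBase_pos
    split_ifs <;> positivity
  rw [glauber_eq_singleSite, singleSite_mulVec_apply, Fintype.card_fin]
  calc 1 / (M : ℝ) * ∑ v, (condProb (gibbs criticalBeta M) σ v ⬝ᵥ fun b => lyap i c (update σ v b))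
      ≤ 1 / (M : ℝ) * ∑ v, lyap i c σ * (if σ v = c then lyapBase else 1) *
          (1 - q * (1 - lyapBase⁻¹)) := by
        simp only [condProb_dotProduct_lyap_update]
        gcongr with v
        · exact hlyap v
        · exact hq v
    _ = lyap i c σ * ((1 + ratio σ c * (lyapBase - 1)) * (1 - q * (1 - lyapBase⁻¹))) := by
        rw [← Finset.sum_mul, ← Finset.mul_sum, ← sum_ite_eq_ratio]
        ring

lemma lyap_update_le_two_mul [NeZero M] (i : Fin 4) (c : Fin 3) (σ : Config M) (v : Fin M)
    (b : Fin 3) : lyap i c (update σ v b) ≤ 2 * lyap i c σ := by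
  have hbase : lyapBase ≤ 2 := by norm_num [lyapBase, rho]
  have hinv : lyapBase⁻¹ ≤ 1 := inv_le_one_of_one_le₀ one_lt_lyapBase.le
  have hinv0 : 0 < lyapBase⁻¹ := inv_pos.2 lyapBase_pos
  have hfac : (if σ v = c then lyapBase else 1) * (if b = c then lyapBase⁻¹ else 1) ≤ 2 * 1 :=
    mul_le_mul (by split_ifs <;> linarith) (by split_ifs <;> linarith)
      (by split_ifs <;> linarith) zero_le_two
  rw [lyap_update, mul_assoc, mul_comm 2]
  exact mul_le_mul_of_nonneg_left (by linarith) (lyap_pos i c σ).le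

lemma glauber_mulVec_lyap_le [NeZero M] (hM : 1 / (M : ℝ) ≤ rho / 1000) (h : σ ∈ core M i)
    (c : Fin 3) :
    (glauber (gibbs criticalBeta M) *ᵥ lyap i c) σ ≤
      lyap i c σ + 2 * exp (-(exitRate * M)) := by
  have hlyap := lyap_pos i c σ
  rcases le_total (ratio σ c) (centre i c - 97 / 100 * rho) with hs | hs
  · refine le_add_of_le_of_nonneg ?_ (by positivity)
    have hC := mem_Icc_of_mem_stdSimplex (centre_mem_stdSimplex i) c
    refine (glauber_mulVec_lyap_le_mul (fun v => centre_sub_le_condProb hM h v c) i).trans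
      (mul_le_of_le_one_right hlyap.le (drift_factor_le_one one_lt_lyapBase.le
        (mem_Icc_of_mem_stdSimplex (ratio_mem_stdSimplex σ) c) ⟨?_, ?_⟩ ?_))
    · linarith [ratio_nonneg σ c, rho_pos]
    · linarith [hC.2, rho_pos]
    · rw [lyapBase]
      linarith [rho_pos]
  · refine le_add_of_nonneg_of_le hlyap.le ?_
    have hstep (v : Fin M) (b : Fin 3) : lyap i c (update σ v b) ≤ 2 * exp (-(exitRate * M)) :=
      (lyap_update_le_two_mul i c σ v b).trans (by gcongr; exact lyap_le_exp hs)
    exact (glauber_mulVec_apply_mono (gibbs_pos _) hstep).trans_eq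
      (mulVec_const (glauber_mem_rowStochastic (gibbs_pos _)) _ σ)

lemma glauber_mulVec_sum_lyap_le [NeZero M] (hM : 1 / (M : ℝ) ≤ rho / 1000) (h : σ ∈ core M i) :
    (glauber (gibbs criticalBeta M) *ᵥ fun σ => ∑ c, lyap i c σ) σ ≤
      ∑ c, lyap i c σ + 6 * exp (-(exitRate * M)) := by
  have hsum : (fun σ : Config M => ∑ c, lyap i c σ) = ∑ c, lyap i c :=
    (Finset.sum_fn _ _).symm
  rw [hsum, mulVec_sum, Finset.sum_apply]
  refine (Finset.sum_le_sum fun c _ => glauber_mulVec_lyap_le hM h c).trans_eq ?_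
  rw [Finset.sum_add_distrib, Finset.sum_const, Finset.card_univ, Fintype.card_fin, nsmul_eq_mul]
  ring

lemma one_le_sum_lyap (h : σ ∉ core M i) : 1 ≤ ∑ c, lyap i c σ := by
  obtain ⟨c, hc⟩ := not_forall.1 h
  have hone : 1 ≤ lyap i c σ :=
    one_le_rpow one_lt_lyapBase.le (mul_nonneg (Nat.cast_nonneg _) (by linarith))
  exact hone.trans (Finset.single_le_sum (f := fun c => lyap i c σ)
    (fun b _ => (lyap_pos i b σ).le) (Finset.mem_univ c))

lemma sum_lyap_le (h : σ ∈ innerRegion M i) :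
    ∑ c, lyap i c σ ≤ 3 * exp (-(exitRate * M)) := by
  have hlyap (c : Fin 3) : lyap i c σ ≤ exp (-(exitRate * M)) :=
    lyap_le_exp (by linarith [(h c).1, rho_pos])
  simpa using Finset.sum_le_card_nsmul Finset.univ _ _ fun c _ => hlyap c

end Lyapunov

section Mode

variable {M : ℕ} {i : Fin 4} {σ : Config M}

lemma mem_mode_of_abs_sub_le (h : ∀ c, |ratio σ c - centre i c| ≤ 3 * rho) : σ ∈ mode M i := by
  have h0 := abs_le.1 (h 0)
  have h1 := abs_le.1 (h 1)
  have h2 := abs_le.1 (h 2)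
  fin_cases i <;> simp [centre, rho] at h0 h1 h2 <;> simp [mode, majority] <;> grind

lemma core_subset_mode [NeZero M] (i : Fin 4) : core M i ⊆ mode M i := fun _ hσ =>
  mem_mode_of_abs_sub_le fun c => by linarith [abs_ratio_sub_centre_le hσ c, rho_pos]

lemma update_mem_mode_of_mem_core [NeZero M] (hM : 1 / (M : ℝ) ≤ rho / 1000) (h : σ ∈ core M i)
    (v : Fin M) (b : Fin 3) : update σ v b ∈ mode M i := by
  refine mem_mode_of_abs_sub_le fun c => ?_
  have hc := abs_le.1 (abs_ratio_sub_centre_le h c)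
  have hv := othersRatio_mem_Icc σ v c
  have hb : (Pi.single b (1 / (M : ℝ)) : Fin 3 → ℝ) c ∈ Set.Icc 0 (1 / (M : ℝ)) := by
    rw [Pi.single_apply]
    split_ifs <;> simp
  rw [ratio_update, Pi.add_apply, abs_le]
  constructor <;> linarith [hc.1, hc.2, hv.1, hv.2, hb.1, hb.2, rho_pos]

lemma glauber_mulVec_indicator_mode [NeZero M] (hM : 1 / (M : ℝ) ≤ rho / 1000)
    (h : σ ∈ core M i) :
    (glauber (gibbs criticalBeta M) *ᵥ (mode M i).indicator 1) σ = 1 := by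
  have hstep (v : Fin M) (b : Fin 3) : (mode M i).indicator (1 : Config M → ℝ) (update σ v b) = 1 :=
    Set.indicator_of_mem (update_mem_mode_of_mem_core hM h v b) 1
  rw [← mulVec_const (glauber_mem_rowStochastic (gibbs_pos criticalBeta)) 1 σ]
  exact le_antisymm (glauber_mulVec_apply_mono (gibbs_pos _) fun v b => (hstep v b).le)
    (glauber_mulVec_apply_mono (gibbs_pos _) fun v b => (hstep v b).ge)

end Mode

section Hyperbolic

lemma two_mul_three_pow_mul_factorial_le (n : ℕ) :
    2 * 3 ^ n * (n + 1).factorial ≤ (2 * (n + 1)).factorial := by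
  induction n with
  | zero => norm_num
  | succ n ih =>
    calc 2 * 3 ^ (n + 1) * (n + 1 + 1).factorial
        = 3 * (n + 2) * (2 * 3 ^ n * (n + 1).factorial) := by
          rw [Nat.factorial_succ (n + 1)]
          ring
      _ ≤ (2 * n + 4) * (2 * n + 3) * (2 * (n + 1)).factorial :=
          Nat.mul_le_mul (by nlinarith) ih
      _ = (2 * (n + 1 + 1)).factorial := by
          rw [show 2 * (n + 1 + 1) = 2 * (n + 1) + 1 + 1 by ring, Nat.factorial_succ,
            Nat.factorial_succ]
          ring

lemma one_add_two_mul_cosh_le (z : ℝ) : 1 + 2 * cosh z ≤ 3 * exp (z ^ 2 / 3) := by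
  have hcosh := (hasSum_nat_add_iff' 1).2 (hasSum_cosh z)
  have hexp : HasSum (fun n : ℕ => (z ^ 2 / 3) ^ n / (n.factorial : ℝ)) (exp (z ^ 2 / 3)) :=
    exp_eq_exp_ℝ ▸ NormedSpace.expSeries_div_hasSum_exp (z ^ 2 / 3)
  have hterm (n : ℕ) : 2 * (z ^ (2 * (n + 1)) / (2 * (n + 1)).factorial) ≤
      3 * ((z ^ 2 / 3) ^ (n + 1) / (n + 1).factorial) := by
    have hfac : 2 * 3 ^ n * ((n + 1).factorial : ℝ) ≤ (2 * (n + 1)).factorial := by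
      exact_mod_cast two_mul_three_pow_mul_factorial_le n
    calc 2 * (z ^ (2 * (n + 1)) / (2 * (n + 1)).factorial)
        ≤ 2 * ((z ^ 2) ^ (n + 1) / (2 * 3 ^ n * (n + 1).factorial)) := by
          rw [pow_mul]
          gcongr
      _ = 3 * ((z ^ 2 / 3) ^ (n + 1) / (n + 1).factorial) := by
          rw [div_pow]
          field_simp
          ring
  have := hasSum_le hterm (hcosh.mul_left 2) (((hasSum_nat_add_iff' 1).2 hexp).mul_left 3)
  norm_num at this
  linarith

lemma hasDerivAt_tanh (z : ℝ) : HasDerivAt tanh (1 / cosh z ^ 2) z := by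
  have h := (hasDerivAt_sinh z).div (hasDerivAt_cosh z) (cosh_pos z).ne'
  rw [← sq, ← sq, cosh_sq_sub_sinh_sq] at h
  exact h.congr_of_eventuallyEq (.of_forall tanh_eq_sinh_div_cosh)

lemma strictConcaveOn_tanh : StrictConcaveOn ℝ (Set.Ici 0) tanh := by
  refine StrictAntiOn.strictConcaveOn_of_deriv (convex_Ici 0)
    (fun z _ => (hasDerivAt_tanh z).continuousAt.continuousWithinAt) ?_
  rw [interior_Ici]
  intro x hx y hy hxy
  rw [(hasDerivAt_tanh x).deriv, (hasDerivAt_tanh y).deriv]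
  have := cosh_strictMonoOn (Set.mem_Ici.2 (le_of_lt hx)) (Set.mem_Ici.2 (le_of_lt hy)) hxy
  have := cosh_pos x
  gcongr

lemma log_cosh_sub_mul_sq_lt {m r z : ℝ} (hr : 0 < r) (hm : tanh r = 2 * m * r)
    (hz : |z| ≠ r) : log (cosh z) - m * z ^ 2 < log (cosh r) - m * r ^ 2 := by
  set f : ℝ → ℝ := fun z => log (cosh z) - m * z ^ 2
  have hderiv (z : ℝ) : HasDerivAt f (tanh z - 2 * m * z) z := by
    refine (((hasDerivAt_cosh z).log (cosh_pos z).ne').sub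
      ((hasDerivAt_pow 2 z).const_mul m)).congr_deriv ?_
    rw [tanh_eq_sinh_div_cosh]
    ring
  have hcont : Continuous f := continuous_iff_continuousAt.2 fun z => (hderiv z).continuousAt
  have hconc : StrictConcaveOn ℝ (Set.Ici 0) fun z => tanh z - 2 * m * z :=
    strictConcaveOn_tanh.sub_convexOn ((LinearMap.mulLeft ℝ (2 * m)).convexOn (convex_Ici 0))
  have hpos (t : ℝ) (ht : t ∈ Set.Ioo 0 r) : 0 < tanh t - 2 * m * t := by
    rw [← openSegment_eq_Ioo hr] at ht
    simpa [hm] using hconc.lt_on_openSegment Set.self_mem_Ici hr.le hr.ne ht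
  have hneg (t : ℝ) (ht : t ∈ Set.Ioi r) : tanh t - 2 * m * t < 0 := by
    have ht0 : 0 < t := hr.trans ht
    have hrt : r ∈ openSegment ℝ 0 t := openSegment_eq_Ioo ht0 ▸ ⟨hr, ht⟩
    simpa [hm] using hconc.lt_on_openSegment Set.self_mem_Ici ht0.le ht0.ne hrt
  have hmono : StrictMonoOn f (Set.Icc 0 r) :=
    strictMonoOn_of_deriv_pos (convex_Icc _ _) hcont.continuousOn fun t ht => by
      rw [interior_Icc] at ht
      exact (hderiv t).deriv ▸ hpos t ht
  have hanti : StrictAntiOn f (Set.Ici r) :=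
    strictAntiOn_of_deriv_neg (convex_Ici _) hcont.continuousOn fun t ht => by
      rw [interior_Ici] at ht
      exact (hderiv t).deriv ▸ hneg t ht
  suffices f |z| < f r by simpa only [f, cosh_abs, sq_abs] using this
  rcases hz.lt_or_gt with h | h
  · exact hmono ⟨abs_nonneg z, h.le⟩ ⟨hr.le, le_rfl⟩ h
  · exact hanti Set.self_mem_Ici h.le h

lemma tanh_log_two_div_two : tanh (log 2 / 2) = 1 / 3 := by
  have hexp : exp (log 2 / 2) = 2 * exp (-(log 2 / 2)) := by
    rw [show log 2 / 2 = log 2 + -(log 2 / 2) by ring, exp_add, exp_log two_pos]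
    ring_nf
  have := exp_pos (-(log 2 / 2))
  rw [tanh_eq_sinh_div_cosh, sinh_eq, cosh_eq, hexp]
  field_simp
  ring

end Hyperbolic

section DualEnergy

/-- The free energy `log ∑ exp (2 β y_c) - β ∑ y_c²` dual to `β ∑ s_c² + entropy`: by convexity,
the energy `β ∑ s_c²` of a configuration dominates its linearisation at every `y`, and the
linearised partition function is `exp (M * dualEnergy β y)`. -/
def dualEnergy (β : ℝ) (y : Fin 3 → ℝ) : ℝ :=
  log (∑ c, exp (2 * β * y c)) - β * ∑ c, y c ^ 2

lemma continuous_dualEnergy (β : ℝ) : Continuous (dualEnergy β) := by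
  unfold dualEnergy
  refine .sub (.log (by fun_prop) fun y => ?_) (by fun_prop)
  exact (Finset.sum_pos (fun c _ => exp_pos _) Finset.univ_nonempty).ne'

lemma dualEnergy_comp_perm (β : ℝ) (y : Fin 3 → ℝ) (e : Equiv.Perm (Fin 3)) :
    dualEnergy β (y ∘ e) = dualEnergy β y := by
  simp only [dualEnergy, Function.comp_apply, Equiv.sum_comp e fun c => exp (2 * β * y c),
    Equiv.sum_comp e fun c => y c ^ 2]

lemma dualEnergy_lt_of_symmetrize {β x w e : ℝ} (hβ : β ∈ Set.Ioo 0 (3 / 2)) (hw : w ≤ x)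
    (he : e ≠ 0) : dualEnergy β ![x, w + e, w - e] < dualEnergy β ![x, w, w] := by
  obtain ⟨hβ0, hβ1⟩ := hβ
  set A := exp (2 * β * x)
  set B := exp (2 * β * w)
  have hBA : B ≤ A := exp_le_exp.2 (by gcongr)
  have hsum : exp (2 * β * (w + e)) + exp (2 * β * (w - e)) = 2 * B * cosh (2 * β * e) := by
    rw [mul_add, mul_sub, sub_eq_add_neg, exp_add, exp_add, cosh_eq]
    ring
  have hle : A + 2 * B * cosh (2 * β * e) ≤ (A + 2 * B) * exp ((2 * β * e) ^ 2 / 3) := by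
    have hexp : 1 ≤ exp ((2 * β * e) ^ 2 / 3) := one_le_exp (by positivity)
    nlinarith [one_add_two_mul_cosh_le (2 * β * e), exp_pos (2 * β * w),
      mul_nonneg (sub_nonneg.2 hBA) (sub_nonneg.2 hexp)]
  have hlog : log (A + 2 * B * cosh (2 * β * e)) ≤ log (A + 2 * B) + (2 * β * e) ^ 2 / 3 := by
    refine (log_le_log (by positivity) hle).trans_eq ?_
    rw [log_mul (by positivity) (exp_pos _).ne', log_exp]
  have hquad : (2 * β * e) ^ 2 / 3 < β * (2 * e ^ 2) := by
    have : 0 < β * e ^ 2 := by positivity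
    nlinarith
  calc dualEnergy β ![x, w + e, w - e]
      = log (A + 2 * B * cosh (2 * β * e)) - β * (x ^ 2 + 2 * w ^ 2) - β * (2 * e ^ 2) := by
        rw [← hsum]
        simp [dualEnergy, Fin.sum_univ_three, ← add_assoc]
        ring
    _ < log (A + 2 * B) - β * (x ^ 2 + 2 * w ^ 2) := by linarith
    _ = dualEnergy β ![x, w, w] := by
        simp [dualEnergy, Fin.sum_univ_three, A, B]
        ring_nf

/-- Being even in `x - 1/2`, the profile gives the ordered centres (`x = 2/3`) and the disordered
one (`x = 1/3`) the same dual energy: this is what makes the parameter critical. -/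
lemma dualEnergy_profile (x : ℝ) : dualEnergy criticalBeta ![x, (1 - x) / 2, (1 - x) / 2] =
    9 / 4 * log 2 + (log (cosh (3 * log 2 * (x - 1 / 2))) -
      1 / (3 * log 2) * (3 * log 2 * (x - 1 / 2)) ^ 2) := by
  have hsum : ∑ c, exp (2 * criticalBeta * ![x, (1 - x) / 2, (1 - x) / 2] c) =
      exp (3 * log 2 + log 2 * (x - 1 / 2)) * cosh (3 * log 2 * (x - 1 / 2)) := by
    have hA : 2 * criticalBeta * x =
        2 * log 2 + log 2 * (x - 1 / 2) + 3 * log 2 * (x - 1 / 2) := by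
      rw [criticalBeta]
      ring
    have hB : 2 * criticalBeta * ((1 - x) / 2) =
        log 2 + log 2 * (x - 1 / 2) + -(3 * log 2 * (x - 1 / 2)) := by
      rw [criticalBeta]
      ring
    have htwo : 2 * log 2 = log 2 + log 2 := two_mul _
    have hthree : 3 * log 2 = log 2 + log 2 + log 2 := by ring
    simp only [Fin.sum_univ_three, cons_val, hA, hB, cosh_eq]
    generalize 3 * log 2 * (x - 1 / 2) = z
    simp only [htwo, hthree, exp_add, exp_log two_pos]
    ring
  rw [dualEnergy, hsum, log_mul (exp_pos _).ne' (cosh_pos _).ne', log_exp, criticalBeta]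
  simp only [Fin.sum_univ_three, cons_val]
  field_simp
  ring

/-- The maximal value of the dual free energy at the critical parameter. -/
def maxEnergy : ℝ := 9 / 4 * log 2 + (log (cosh (log 2 / 2)) - 1 / (3 * log 2) * (log 2 / 2) ^ 2)

lemma dualEnergy_profile_of_abs_eq {x : ℝ} (hx : |x - 1 / 2| = 1 / 6) :
    dualEnergy criticalBeta ![x, (1 - x) / 2, (1 - x) / 2] = maxEnergy := by
  have hz : |3 * log 2 * (x - 1 / 2)| = log 2 / 2 := by
    rw [abs_mul, hx, abs_of_pos (by positivity [log_pos one_lt_two])]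
    ring
  rw [dualEnergy_profile, maxEnergy, ← cosh_abs, ← sq_abs (3 * log 2 * _), hz]

lemma dualEnergy_profile_lt {x : ℝ} (hx : |x - 1 / 2| ≠ 1 / 6) :
    dualEnergy criticalBeta ![x, (1 - x) / 2, (1 - x) / 2] < maxEnergy := by
  have hlog : 0 < log 2 := log_pos one_lt_two
  rw [dualEnergy_profile, maxEnergy]
  gcongr 9 / 4 * log 2 + ?_
  refine log_cosh_sub_mul_sq_lt (by positivity) ?_ fun h => hx ?_
  · rw [tanh_log_two_div_two]
    field_simp
  · rw [abs_mul, abs_of_pos (by positivity)] at h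
    have : log 2 * (6 * |x - 1 / 2|) = log 2 * 1 := by linarith
    linarith [mul_left_cancel₀ hlog.ne' this]

lemma centre_castSucc_comp_addLeft (a : Fin 3) :
    centre a.castSucc ∘ Equiv.addLeft a = ![2 / 3, 1 / 6, 1 / 6] := by
  ext c
  fin_cases a <;> fin_cases c <;> rfl

lemma centre_last (c : Fin 3) : centre (Fin.last 3) c = 1 / 3 := by
  fin_cases c <;> rfl

lemma exists_eq_centre {y : Fin 3 → ℝ} {a : Fin 3} {x : ℝ} (hx : |x - 1 / 2| = 1 / 6)
    (hy : y ∘ Equiv.addLeft a = ![x, (1 - x) / 2, (1 - x) / 2]) : ∃ i, y = centre i := by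
  rcases eq_or_eq_neg_of_abs_eq hx with hx | hx
  · refine ⟨a.castSucc, (Equiv.addLeft a).surjective.injective_comp_right ?_⟩
    simp only [hy, centre_castSucc_comp_addLeft, show x = 2 / 3 by linarith]
    norm_num
  · refine ⟨Fin.last 3, (Equiv.addLeft a).surjective.injective_comp_right (hy.trans ?_)⟩
    ext c
    change _ = centre (Fin.last 3) (Equiv.addLeft a c)
    rw [centre_last, show x = 1 / 3 by linarith]
    fin_cases c <;> norm_num

lemma dualEnergy_centre (i : Fin 4) : dualEnergy criticalBeta (centre i) = maxEnergy := by
  induction i using Fin.lastCases with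
  | last =>
    rw [← dualEnergy_profile_of_abs_eq (x := 1 / 3) (by norm_num [abs_of_neg])]
    norm_num [centre, Fin.last]
  | cast a =>
    rw [← dualEnergy_comp_perm _ _ (Equiv.addLeft a), centre_castSucc_comp_addLeft,
      ← dualEnergy_profile_of_abs_eq (x := 2 / 3) (by norm_num)]
    norm_num

lemma dualEnergy_lt {y : Fin 3 → ℝ} (hy : ∑ c, y c = 1) (hne : ∀ i, y ≠ centre i) :
    dualEnergy criticalBeta y < maxEnergy := by
  obtain ⟨a, ha⟩ := Finite.exists_max y
  set x := y a
  set w := (1 - x) / 2 with hw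
  set e := (y (a + 1) - y (a + 2)) / 2 with he
  have hsum : x + y (a + 1) + y (a + 2) = 1 := by
    rw [← hy, ← Equiv.sum_comp (Equiv.addLeft a), Fin.sum_univ_three]
    simp [x]
  have hrot : y ∘ Equiv.addLeft a = ![x, w + e, w - e] := by
    ext c
    fin_cases c
    · simp [x]
    · simp
      linarith
    · simp
      linarith
  rw [← dualEnergy_comp_perm _ _ (Equiv.addLeft a), hrot]
  have hprofile_le : dualEnergy criticalBeta ![x, w, w] ≤ maxEnergy := by
    by_cases hx : |x - 1 / 2| = 1 / 6
    · exact (dualEnergy_profile_of_abs_eq hx).le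
    · exact (dualEnergy_profile_lt hx).le
  by_cases he0 : e = 0
  · rw [he0, add_zero, sub_zero] at hrot ⊢
    refine dualEnergy_profile_lt fun hx => ?_
    obtain ⟨i, hi⟩ := exists_eq_centre hx hrot
    exact hne i hi
  · refine (dualEnergy_lt_of_symmetrize ?_ ?_ he0).trans_le hprofile_le
    · constructor <;> linarith [two_mul_criticalBeta_pos, two_mul_criticalBeta_lt]
    · linarith [ha (a + 1), ha (a + 2)]

end DualEnergy

section Tangent

variable {M : ℕ}

/-- The Gibbs weight with the energy `s_c²` of every colour replaced by its tangent
`2 y_c s_c - y_c²` at `y_c`: a product weight, below the Gibbs weight. -/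
def tangentWeight (β : ℝ) (y : Fin 3 → ℝ) (σ : Config M) : ℝ :=
  exp (M * β * ∑ c, (2 * y c * ratio σ c - y c ^ 2))

lemma tangentWeight_pos (β : ℝ) (y : Fin 3 → ℝ) (σ : Config M) : 0 < tangentWeight β y σ :=
  exp_pos _

lemma tangentWeight_ratio (β : ℝ) (σ : Config M) :
    tangentWeight β (ratio σ) σ = weight β σ := by
  unfold tangentWeight weight
  congr! 3
  ring

lemma tangentWeight_le_weight {β : ℝ} (hβ : 0 ≤ β) (y : Fin 3 → ℝ) (σ : Config M) :
    tangentWeight β y σ ≤ weight β σ := by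
  unfold tangentWeight weight
  gcongr with c
  linarith [sq_nonneg (ratio σ c - y c)]

lemma sum_exp_mul_ratio [NeZero M] (z : Fin 3 → ℝ) :
    ∑ σ : Config M, exp (M * ∑ c, z c * ratio σ c) = (∑ c, exp (z c)) ^ M := by
  have hM : (M : ℝ) ≠ 0 := NeZero.ne _
  rw [Fintype.sum_pow]
  refine Finset.sum_congr rfl fun σ _ => ?_
  rw [← exp_sum]
  simp only [ratio_eq_sum_single_div, mul_div_assoc', ← Finset.sum_div, mul_div_cancel₀ _ hM,
    Finset.mul_sum]
  rw [Finset.sum_comm]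
  simp [Pi.single_apply]

lemma sum_tangentWeight_mul_exp [NeZero M] (β : ℝ) (y z : Fin 3 → ℝ) :
    ∑ σ : Config M, tangentWeight β y σ * exp (M * ∑ c, z c * ratio σ c) =
      (∑ c, exp (2 * β * y c) * exp (z c)) ^ M * exp (-(M * β * ∑ c, y c ^ 2)) := by
  simp only [← exp_add]
  rw [← sum_exp_mul_ratio fun c => 2 * β * y c + z c, Finset.sum_mul]
  refine Finset.sum_congr rfl fun σ _ => ?_
  rw [tangentWeight, ← exp_add, ← exp_add]
  simp only [Finset.sum_sub_distrib, add_mul, Finset.sum_add_distrib, mul_assoc, ← Finset.mul_sum]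
  ring_nf

lemma sum_tangentWeight [NeZero M] (β : ℝ) (y : Fin 3 → ℝ) :
    ∑ σ : Config M, tangentWeight β y σ = exp (M * dualEnergy β y) := by
  have hpos : 0 < ∑ c, exp (2 * β * y c) := by positivity
  have h := sum_tangentWeight_mul_exp (M := M) β y 0
  simp only [Pi.zero_apply, zero_mul, Finset.sum_const_zero, mul_zero, exp_zero, mul_one] at h
  rw [h, dualEnergy, mul_sub, sub_eq_add_neg, exp_add, exp_nat_mul, exp_log hpos, mul_assoc]

lemma card_image_ratio_le (s : Finset (Config M)) : (s.image ratio).card ≤ (M + 1) ^ 3 := by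
  have hsub : s.image ratio ⊆ (Finset.univ : Finset (Fin 3 → Fin (M + 1))).image
      fun n c => ((n c : ℕ) : ℝ) / M := by
    refine Finset.image_subset_iff.2 fun σ _ => Finset.mem_image.2
      ⟨fun c => ⟨(Finset.univ.filter fun l => σ l = c).card, ?_⟩, Finset.mem_univ _, rfl⟩
    simpa [Nat.lt_succ_iff] using Finset.card_le_univ (Finset.univ.filter fun l => σ l = c)
  calc (s.image ratio).card
      ≤ (Finset.univ : Finset (Fin 3 → Fin (M + 1))).card :=
        (Finset.card_le_card hsub).trans Finset.card_image_le
    _ = (M + 1) ^ 3 := by simp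

lemma mass_weight_le [NeZero M] {β m : ℝ} {S : Set (Config M)}
    (hS : ∀ σ ∈ S, dualEnergy β (ratio σ) ≤ m) :
    mass (weight β) S ≤ (M + 1) ^ 3 * exp (M * m) := by
  set T := S.toFinite.toFinset.image ratio
  calc mass (weight β) S
      ≤ ∑ σ : Config M, ∑ y ∈ T, tangentWeight β y σ := by
        refine Finset.sum_le_sum fun σ _ => ?_
        have hnonneg : ∀ y ∈ T, 0 ≤ tangentWeight β y σ := fun y _ => (tangentWeight_pos β y σ).le
        refine Set.indicator_apply_le' (fun hσ => ?_) fun _ => Finset.sum_nonneg hnonneg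
        rw [← tangentWeight_ratio]
        exact Finset.single_le_sum hnonneg
          (Finset.mem_image_of_mem ratio (S.toFinite.mem_toFinset.2 hσ))
    _ = ∑ y ∈ T, exp (M * dualEnergy β y) := by
        rw [Finset.sum_comm]
        exact Finset.sum_congr rfl fun y _ => sum_tangentWeight β y
    _ ≤ ∑ _y ∈ T, exp (M * m) := by
        gcongr with y hy
        obtain ⟨σ, hσ, rfl⟩ := Finset.mem_image.1 hy
        exact hS σ (S.toFinite.mem_toFinset.1 hσ)
    _ = T.card * exp (M * m) := by rw [Finset.sum_const, nsmul_eq_mul]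
    _ ≤ (M + 1) ^ 3 * exp (M * m) := by
        gcongr
        exact_mod_cast card_image_ratio_le _

end Tangent

section Concentration

variable {M : ℕ}

/-- At a centre, the tangent weight is proportional to the law of independent spins with colour
distribution `centre i`. -/
lemma sum_tangentWeight_centre_mul_exp [NeZero M] (i : Fin 4) (z : Fin 3 → ℝ) :
    ∑ σ : Config M, tangentWeight criticalBeta (centre i) σ * exp (M * ∑ c, z c * ratio σ c) =
      exp (M * maxEnergy) * (∑ c, centre i c * exp (z c)) ^ M := by
  obtain ⟨K, -, hK⟩ := exists_exp_centre_eq i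
  have htotal := sum_tangentWeight_mul_exp (M := M) criticalBeta (centre i) 0
  simp only [Pi.zero_apply, zero_mul, Finset.sum_const_zero, mul_zero, exp_zero, mul_one, hK,
    ← Finset.mul_sum, (centre_mem_stdSimplex i).2] at htotal
  rw [← dualEnergy_centre i, ← sum_tangentWeight, htotal, sum_tangentWeight_mul_exp]
  simp only [hK]
  simp only [mul_assoc, ← Finset.mul_sum, mul_pow]
  ring

lemma sum_centre_mul_exp_single (i : Fin 4) (c : Fin 3) (t : ℝ) :
    ∑ b, centre i b * exp ((Pi.single c t : Fin 3 → ℝ) b) = centre i c * (exp t - 1) + 1 := by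
  have hexp (b : Fin 3) : exp ((Pi.single c t : Fin 3 → ℝ) b) =
      (Pi.single c (exp t - 1) : Fin 3 → ℝ) b + 1 := by
    simp only [Pi.single_apply]
    split_ifs <;> simp
  simp only [hexp, mul_add, Finset.sum_add_distrib, mul_one, (centre_mem_stdSimplex i).2]
  simp [Pi.single_apply]

lemma centre_le (i : Fin 4) (c : Fin 3) : centre i c ≤ 2 / 3 := by
  fin_cases i <;> fin_cases c <;> norm_num [centre]

lemma sum_centre_mul_exp_single_neg_rho_le (i : Fin 4) (c : Fin 3) :
    ∑ b, centre i b * exp ((Pi.single c (-rho) : Fin 3 → ℝ) b) ≤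
      exp (-(centre i c * (rho - rho ^ 2))) := by
  have hquad : exp (-rho) ≤ 1 - rho + rho ^ 2 := by
    have h := abs_le.1 (abs_exp_sub_one_sub_id_le (x := -rho) (by norm_num [rho]))
    linarith [h.2]
  rw [sum_centre_mul_exp_single]
  calc centre i c * (exp (-rho) - 1) + 1
      ≤ exp (centre i c * (exp (-rho) - 1)) := add_one_le_exp _
    _ ≤ exp (-(centre i c * (rho - rho ^ 2))) := by
        gcongr
        nlinarith [(centre_mem_stdSimplex i).1 c]

lemma mass_tangentWeight_ratio_lt_le [NeZero M] (i : Fin 4) (c : Fin 3) :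
    mass (tangentWeight criticalBeta (centre i))
      {σ : Config M | ratio σ c < centre i c - rho} ≤
        exp (M * maxEnergy) * exp (-(rho ^ 2 / 3 * M)) := by
  have hrho := rho_pos
  calc _ ≤ ∑ σ : Config M, tangentWeight criticalBeta (centre i) σ *
        exp (M * ∑ b, (Pi.single c (-rho) : Fin 3 → ℝ) b * ratio σ b) *
          exp (M * (rho * (centre i c - rho))) := by
        refine Finset.sum_le_sum fun σ _ => Set.indicator_apply_le' (fun hσ => ?_) fun _ => ?_
        · rw [mul_assoc, ← exp_add]
          refine le_mul_of_one_le_right (tangentWeight_pos _ _ σ).le (one_le_exp ?_)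
          have hσ : 0 ≤ centre i c - rho - ratio σ c := by linarith [Set.mem_ofPred.1 hσ]
          simp only [Pi.single_apply, ite_mul, zero_mul, Finset.sum_ite_eq', Finset.mem_univ,
            if_true]
          have : 0 ≤ M * (rho * (centre i c - rho - ratio σ c)) := by positivity
          linarith
        · have := tangentWeight_pos criticalBeta (centre i) σ
          positivity
    _ ≤ exp (M * maxEnergy) * exp (-(centre i c * (rho - rho ^ 2))) ^ M *
          exp (M * (rho * (centre i c - rho))) := by
        rw [← Finset.sum_mul, sum_tangentWeight_centre_mul_exp]
        gcongr
        · exact Finset.sum_nonneg fun b _ =>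
            mul_nonneg ((centre_mem_stdSimplex i).1 b) (exp_pos _).le
        · exact sum_centre_mul_exp_single_neg_rho_le i c
    _ = exp (M * maxEnergy) * exp (-((1 - centre i c) * rho ^ 2 * M)) := by
        rw [mul_assoc, ← exp_nat_mul, ← exp_add]
        ring_nf
    _ ≤ exp (M * maxEnergy) * exp (-(rho ^ 2 / 3 * M)) := by
        gcongr
        nlinarith [centre_le i c]

lemma half_exp_le_mass_weight_core [NeZero M] (hM : 6 * exp (-(rho ^ 2 / 3 * M)) ≤ 1)
    (i : Fin 4) : 1 / 2 * exp (M * maxEnergy) ≤ mass (weight criticalBeta) (core M i) := by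
  set μ : Config M → ℝ := tangentWeight criticalBeta (centre i)
  have hμ (σ : Config M) : 0 ≤ μ σ := (tangentWeight_pos _ _ σ).le
  have hsplit (σ : Config M) : μ σ ≤ (core M i).indicator (weight criticalBeta) σ +
      ∑ c, {σ | ratio σ c < centre i c - rho}.indicator μ σ := by
    have hnonneg : ∀ c ∈ Finset.univ,
        0 ≤ {σ | ratio σ c < centre i c - rho}.indicator μ σ := fun c _ =>
      Set.indicator_nonneg (fun σ _ => hμ σ) σ
    by_cases hσ : σ ∈ core M i
    · rw [Set.indicator_of_mem hσ]
      exact (tangentWeight_le_weight (by linarith [two_mul_criticalBeta_pos]) _ σ).trans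
        (le_add_of_nonneg_right (Finset.sum_nonneg hnonneg))
    · obtain ⟨c, hc⟩ : ∃ c, ratio σ c < centre i c - rho := by
        simpa only [core, Set.mem_ofPred_eq, not_forall, not_le] using hσ
      rw [Set.indicator_of_notMem hσ, zero_add]
      refine le_trans ?_ (Finset.single_le_sum hnonneg (Finset.mem_univ c))
      exact (Set.indicator_of_mem (s := {σ | ratio σ c < centre i c - rho}) hc μ).ge
  have htail : ∑ c, mass μ {σ : Config M | ratio σ c < centre i c - rho} ≤
      1 / 2 * exp (M * maxEnergy) :=
    calc _ ≤ ∑ _c : Fin 3, exp (M * maxEnergy) * exp (-(rho ^ 2 / 3 * M)) :=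
          Finset.sum_le_sum fun c _ => mass_tangentWeight_ratio_lt_le i c
      _ ≤ 1 / 2 * exp (M * maxEnergy) := by
          rw [Finset.sum_const, Finset.card_univ, Fintype.card_fin, nsmul_eq_mul]
          have := exp_pos (M * maxEnergy)
          push_cast
          nlinarith
  have hsum := Finset.sum_le_sum fun σ (_ : σ ∈ Finset.univ) => hsplit σ
  rw [sum_tangentWeight, dualEnergy_centre, Finset.sum_add_distrib, Finset.sum_comm] at hsum
  unfold mass at htail ⊢
  linarith

lemma exists_dualEnergy_le_of_forall_exists_le : ∃ m < maxEnergy, ∀ y ∈ stdSimplex ℝ (Fin 3),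
    (∀ i, ∃ c, y c ≤ centre i c - rho) → dualEnergy criticalBeta y ≤ m := by
  set K : Set (Fin 3 → ℝ) := stdSimplex ℝ (Fin 3) ∩ ⋂ i, ⋃ c, {y | y c ≤ centre i c - rho}
  have hK : IsCompact K := (isCompact_stdSimplex ℝ (Fin 3)).inter_right <| isClosed_iInter fun i =>
    isClosed_iUnion_of_finite fun c => isClosed_le (continuous_apply c) continuous_const
  have hlt : ∀ y ∈ K, dualEnergy criticalBeta y < maxEnergy := fun y hy =>
    dualEnergy_lt hy.1.2 fun i hi => by
      obtain ⟨c, hc⟩ := Set.mem_iUnion.1 (Set.mem_iInter.1 hy.2 i)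
      linarith [congrFun hi c, rho_pos, Set.mem_ofPred.1 hc]
  obtain ⟨m, hm, hmK⟩ := hK.exists_forall_le' (α := ℝᵒᵈ)
    (continuous_dualEnergy criticalBeta).continuousOn hlt
  exact ⟨m, hm, fun y hy h => hmK y ⟨hy, by simpa using h⟩⟩

lemma eq_of_mem_mode [NeZero M] {i j : Fin 4} {σ : Config M} (hi : σ ∈ mode M i)
    (hj : σ ∈ mode M j) : i = j := by
  have hsum := sum_ratio σ
  have hnonneg := ratio_nonneg σ
  rw [Fin.sum_univ_three] at hsum
  fin_cases i <;> fin_cases j <;> simp [mode, majority] at hi hj ⊢ <;>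
    linarith [hnonneg 0, hnonneg 1, hnonneg 2]

lemma exists_ratio_le_of_mem_mode_diff_core [NeZero M] {i : Fin 4} {σ : Config M}
    (hσ : σ ∈ mode M i \ core M i) (j : Fin 4) : ∃ c, ratio σ c ≤ centre j c - rho := by
  by_contra! hj
  have hcore : σ ∈ core M j := fun c => (hj c).le
  obtain rfl : i = j := eq_of_mem_mode hσ.1 (core_subset_mode j hcore)
  exact hσ.2 hcore

lemma mass_gibbs (β : ℝ) (F : Set (Config M)) :
    mass (gibbs β M) F = mass (weight β) F / ∑ τ : Config M, weight β τ := by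
  rw [mass, mass, Finset.sum_div]
  refine Finset.sum_congr rfl fun σ _ => ?_
  by_cases hσ : σ ∈ F <;> simp [hσ, gibbs]

lemma exists_mass_mode_diff_core_le : ∃ g > 0, ∀ (M : ℕ) [NeZero M],
    6 * exp (-(rho ^ 2 / 3 * M)) ≤ 1 → ∀ i, 0 < mass (gibbs criticalBeta M) (mode M i) ∧
      mass (gibbs criticalBeta M) (mode M i \ core M i) / mass (gibbs criticalBeta M) (mode M i) ≤
        2 * (M + 1) ^ 3 * exp (-(g * M)) := by
  obtain ⟨m, hm, hgap⟩ := exists_dualEnergy_le_of_forall_exists_le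
  refine ⟨maxEnergy - m, sub_pos.2 hm, fun M _ hM i => ?_⟩
  have hZ : 0 < ∑ τ : Config M, weight criticalBeta τ :=
    Finset.sum_pos (fun _ _ => exp_pos _) Finset.univ_nonempty
  have hmode : 1 / 2 * exp (M * maxEnergy) ≤ mass (weight criticalBeta) (mode M i) :=
    (half_exp_le_mass_weight_core hM i).trans <| Finset.sum_le_sum fun σ _ =>
      Set.indicator_le_indicator_of_subset (core_subset_mode i) (fun _ => (exp_pos _).le) σ
  have hdiff : mass (weight criticalBeta) (mode M i \ core M i) ≤ (M + 1) ^ 3 * exp (M * m) :=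
    mass_weight_le fun σ hσ =>
      hgap _ (ratio_mem_stdSimplex σ) (exists_ratio_le_of_mem_mode_diff_core hσ)
  have hpos : 0 < mass (weight criticalBeta) (mode M i) := lt_of_lt_of_le (by positivity) hmode
  rw [mass_gibbs, mass_gibbs, div_div_div_cancel_right₀ hZ.ne']
  refine ⟨div_pos hpos hZ, (div_le_iff₀ hpos).2 ?_⟩
  calc mass (weight criticalBeta) (mode M i \ core M i)
      ≤ (M + 1) ^ 3 * exp (M * m) := hdiff
    _ = 2 * (M + 1) ^ 3 * exp (-((maxEnergy - m) * M)) * (1 / 2 * exp (M * maxEnergy)) := by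
        rw [show M * m = -((maxEnergy - m) * M) + M * maxEnergy by ring, exp_add]
        ring
    _ ≤ 2 * (M + 1) ^ 3 * exp (-((maxEnergy - m) * M)) *
          mass (weight criticalBeta) (mode M i) := by gcongr

end Concentration

section Mixing

variable {M : ℕ}

lemma mul_one_sub_div_pow_le [NeZero M] {k : ℕ} (hk : 330 * (M : ℝ) * log M ≤ k) :
    (M : ℝ) * (1 - 7 / 100 / M) ^ k ≤ 1 / (M : ℝ) ^ 2 := by
  have hM : (1 : ℝ) ≤ M := Nat.one_le_cast.2 NeZero.one_le
  have hlog : 0 ≤ log M := log_nonneg hM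
  have hdiv : 7 / 100 / (M : ℝ) ≤ 1 := by
    rw [div_le_one (by positivity)]
    linarith
  have hexponent : -(7 / 100 / (M : ℝ)) * k ≤ -(log M * (3 : ℕ)) := by
    have h : 7 / 100 / (M : ℝ) * (330 * M * log M) ≤ 7 / 100 / M * k := by gcongr
    have : 7 / 100 / (M : ℝ) * (330 * M * log M) = 23.1 * log M := by
      field_simp
      ring
    push_cast
    linarith
  calc (M : ℝ) * (1 - 7 / 100 / M) ^ k
      ≤ M * exp (-(7 / 100 / M)) ^ k := by
        gcongr
        exact one_sub_le_exp_neg _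
    _ = M * exp (-(7 / 100 / M) * k) := by rw [mul_comm (-_) (k : ℝ), exp_nat_mul]
    _ ≤ M * exp (-(log M * (3 : ℕ))) := by gcongr
    _ = 1 / (M : ℝ) ^ 2 := by
        rw [Real.exp_neg, mul_comm (log _), exp_nat_mul, exp_log (by positivity)]
        field_simp

lemma dTV_glauber_pow_le [NeZero M] (hM : 1 / (M : ℝ) ≤ rho / 1000) {i : Fin 4} {k : ℕ}
    {σ : Config M} (hmode : 0 < mass (gibbs criticalBeta M) (mode M i))
    (hk : 330 * (M : ℝ) * log M ≤ k) (hσ : σ ∈ innerRegion M i) :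
    dTV ((glauber (gibbs criticalBeta M) ^ k) σ) (restrictTo (gibbs criticalBeta M) (mode M i)) ≤
      1 / (M : ℝ) ^ 2 + (3 + 6 * k) * exp (-(exitRate * M)) + 2 * k *
        (mass (gibbs criticalBeta M) (mode M i \ core M i) /
          mass (gibbs criticalBeta M) (mode M i)) := by
  have hμ := gibbs_pos criticalBeta (M := M)
  have h := dTV_pow_restrictTo_le (glauber_mem_rowStochastic hμ)
    (singleSite_mem_rowStochastic (clippedProb_mem_stdSimplex i))
    (fun σ hσ => glauber_eq_clipped hM hσ) (fun σ => (hμ σ).le) (vecMul_glauber hμ) hmode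
    (fun σ hσ => glauber_mulVec_indicator_mode hM hσ) (by positivity)
    (fun σ => Finset.sum_nonneg fun c _ => (lyap_pos i c σ).le)
    (fun σ hσ => one_le_sum_lyap hσ) (fun σ hσ => glauber_mulVec_sum_lyap_le hM hσ)
    (fun f hf σ τ => abs_clipped_pow_mulVec_sub_le i hf k σ τ) σ
  linarith [mul_one_sub_div_pow_le hk, sum_lyap_le hσ]

lemma exists_exp_add_pow_mul_exp_le {a b : ℝ} (ha : 0 < a) (hb : 0 < b) : ∃ C > 0,
    ∀ᶠ M : ℕ in Filter.atTop, ∀ k : ℕ, 1 ≤ k →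
      (3 + 6 * k) * exp (-(a * M)) + 2 * k * (2 * (M + 1) ^ 3 * exp (-(b * M))) ≤
        3 * k ^ 2 * exp (-C * M) := by
  set C := min a b / 2 with hC
  have hC_pos : 0 < C := by positivity
  have hCa : 2 * C ≤ a := by linarith [min_le_left a b]
  have hCb : 2 * C ≤ b := by linarith [min_le_right a b]
  have hpow := ((isLittleO_pow_exp_pos_mul_atTop 3 hC_pos).comp_tendsto <|
    Filter.tendsto_atTop_add_const_right _ 1 tendsto_natCast_atTop_atTop).bound
      (show 0 < 3 / 13 * exp (-C) by positivity)
  refine ⟨C, hC_pos, hpow.mono fun M hM k hk => ?_⟩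
  have hcube : 9 + 4 * ((M : ℝ) + 1) ^ 3 ≤ 3 * exp (C * M) := by
    have hone : 1 ≤ ((M : ℝ) + 1) ^ 3 := one_le_pow₀ (by linarith [M.cast_nonneg (α := ℝ)])
    simp only [Function.comp_apply, norm_eq_abs, abs_exp] at hM
    rw [abs_of_nonneg (by positivity), mul_assoc, ← exp_add,
      show -C + C * (M + 1) = C * M by ring] at hM
    linarith
  have hk_one : (1 : ℝ) ≤ k := Nat.one_le_cast.2 hk
  have hk_sq : (k : ℝ) ≤ k ^ 2 := le_self_pow₀ hk_one two_ne_zero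
  calc (3 + 6 * k) * exp (-(a * M)) + 2 * k * (2 * (M + 1) ^ 3 * exp (-(b * M)))
      ≤ (9 * k ^ 2) * exp (-(2 * C * M)) +
          2 * k ^ 2 * (2 * (M + 1) ^ 3 * exp (-(2 * C * M))) := by
        gcongr
        linarith
    _ = k ^ 2 * (9 + 4 * (M + 1) ^ 3) * exp (-(2 * C * M)) := by ring
    _ ≤ k ^ 2 * (3 * exp (C * M)) * exp (-(2 * C * M)) := by gcongr
    _ = 3 * k ^ 2 * (exp (C * M) * exp (-(2 * C * M))) := by ring
    _ = 3 * k ^ 2 * exp (-C * M) := by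
        rw [← exp_add]
        ring_nf

lemma eventually_one_div_le_and_exp_le : ∀ᶠ M : ℕ in Filter.atTop, 1 < M ∧
    1 / (M : ℝ) ≤ rho / 1000 ∧ 6 * exp (-(rho ^ 2 / 3 * M)) ≤ 1 := by
  have hinv : Filter.Tendsto (fun M : ℕ => 1 / (M : ℝ)) Filter.atTop (nhds 0) :=
    tendsto_const_div_atTop_nhds_zero_nat 1
  have hexp : Filter.Tendsto (fun M : ℕ => 6 * exp (-(rho ^ 2 / 3 * M))) Filter.atTop
      (nhds (6 * 0)) :=
    (tendsto_exp_neg_atTop_nhds_zero.comp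
      (tendsto_natCast_atTop_atTop.const_mul_atTop (by norm_num [rho]))).const_mul 6
  exact (Filter.eventually_gt_atTop 1).and ((hinv.eventually_le_const (by norm_num [rho])).and
    (hexp.eventually_le_const (by norm_num)))

end Mixing

end MeanFieldPotts

end

theorem mainTheorem8 :
    ∃ C : ℝ, 0 < C ∧ ∃ C' : ℝ, 0 < C' ∧ ∃ M₀ : ℕ, ∀ M : ℕ, M₀ ≤ M →
      ∀ k : ℕ, 330 * (M : ℝ) * Real.log (M : ℝ) ≤ (k : ℝ) →
        ∀ (i : Fin 4) (σ : MeanFieldPotts.Config M), σ ∈ MeanFieldPotts.innerRegion M i →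
          MeanFieldPotts.dTV
              ((MeanFieldPotts.glauber
                (MeanFieldPotts.gibbs MeanFieldPotts.criticalBeta M) ^ k) σ)
              (MeanFieldPotts.restrictTo
                (MeanFieldPotts.gibbs MeanFieldPotts.criticalBeta M) (MeanFieldPotts.mode M i))
            ≤ C / (M : ℝ) ^ 2 + 3 * (k : ℝ) ^ 2 * Real.exp (-C' * (M : ℝ)) := by
  obtain ⟨g, hg, hconc⟩ := MeanFieldPotts.exists_mass_mode_diff_core_le
  obtain ⟨C', hC', herror⟩ :=
    MeanFieldPotts.exists_exp_add_pow_mul_exp_le MeanFieldPotts.exitRate_pos hg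
  obtain ⟨M₀, hM₀⟩ := Filter.eventually_atTop.1
    (MeanFieldPotts.eventually_one_div_le_and_exp_le.and herror)
  refine ⟨1, one_pos, C', hC', M₀, fun M hM k hk i σ hσ => ?_⟩
  obtain ⟨⟨hM_one, hM_inv, hM_exp⟩, herror⟩ := hM₀ M hM
  have : NeZero M := ⟨by lia⟩
  have hk_one : 1 ≤ k := by
    have hlog : 0 < Real.log M := Real.log_pos (Nat.one_lt_cast.2 hM_one)
    exact Nat.cast_pos.1 (lt_of_lt_of_le (by positivity) hk)
  obtain ⟨hmode, htail⟩ := hconc M hM_exp i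
  have htail := mul_le_mul_of_nonneg_left htail (show 0 ≤ 2 * (k : ℝ) by positivity)
  linarith [MeanFieldPotts.dTV_glauber_pow_le hM_inv hmode hk hσ, herror k hk_one]
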